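/- Let $G$ be a (finite-dimensional, Hausdorff, smooth) Lie group with Lie algebra $\mathfrak g=T_1G$, equipped with a left-invariant Riemannian metric; let $\|\cdot\|$ denote the norm of the metric on each tangent space, in particular on $\mathfrak g$. For $g\in G$ let $L_g$ denote left translation by $g$, acting on elements of $G$ and, through its differential, on tangent vectors. Let $AC([0,1],G)$ be the set of absolutely continuous curves $\alpha:[0,1]\to G$, that is, of continuous curves that are locally absolutely continuous when read in charts of $G$. Every $\alpha\in AC([0,1],G)$ is differentiable at almost every $t\in[0,1]$. Put $$q_\alpha(t)=\begin{cases} L_{\alpha(t)^{-1}}\dfrac{\alpha'(t)}{\sqrt{\|\alpha'(t)\|}} & \text{if }\alpha'(t)\ne 0,\\[2mm] 0 & \text{if }\alpha'(t)=0.\end{cases}$$ Then $q_\alpha\in L^2([0,1],\mathfrak g)$ for every $\alpha\in AC([0,1],G)$, and the map $$Q: AC([0,1],G)\to G\times L^2([0,1],\mathfrak g),\qquad Q(\alpha)=(\alpha(0),q_\alpha),$$ is a bijection. Moreover, for every $q\in L^2([0,1],\mathfrak g)$ the function $\|q\|q$ belongs to $L^1([0,1],\mathfrak g)$, and for all $\alpha\in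 AC([0,1],G)$, $\alpha_0\in G$ and $q\in L^2([0,1],\mathfrak g)$ one has $Q(\alpha)=(\alpha_0,q)$ if and only if $$\alpha(0)=\alpha_0\quad\text{and}\quad \alpha \text{ is differentiable at } t \text{ with } \alpha'(t)=L_{\alpha(t)}\bigl(\|q(t)\|\,q(t)\bigr)\ \text{ for almost every } t\in[0,1].$$ -/

import Mathlib

open Set MeasureTheory Bundle
open scoped Manifold ContDiff

noncomputable section

/-- A Riemannian metric on a Lie group `G` is left invariant if every left translation
`L_g : x ↦ g * x` is an isometry on tangent spaces. -/
def IsLeftInvariantMetric (E : Type*) [NormedAddCommGroup E] [NormedSpace ℝ E]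
    (G : Type*) [TopologicalSpace G] [ChartedSpace E G] [Group G]
    [RiemannianBundle (fun x : G ↦ TangentSpace 𝓘(ℝ, E) x)] : Prop :=
  ∀ (g h : G) (v w : TangentSpace 𝓘(ℝ, E) h),
    inner ℝ (mfderiv 𝓘(ℝ, E) 𝓘(ℝ, E) (fun x : G ↦ g * x) h v)
      (mfderiv 𝓘(ℝ, E) 𝓘(ℝ, E) (fun x : G ↦ g * x) h w) = inner ℝ v w

/-- Absolutely continuous curves `[0,1] → G` in a manifold `G` modelled on `E`: continuous curves
which, near every time `t`, are absolutely continuous when read in the chart of `G` at the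
point `α t`. Since an absolutely continuous function `ℝ → E` is a function of a variable in `ℝ`,
the curve is extended to `ℝ` by its end values; only times in `[0,1]` matter. -/
structure ACCurve (E : Type*) [NormedAddCommGroup E] [NormedSpace ℝ E]
    (G : Type*) [TopologicalSpace G] [ChartedSpace E G] where
  /-- the underlying continuous curve -/
  curve : C(unitInterval, G)
  locally_ac : ∀ t ∈ Icc (0 : ℝ) 1, ∃ ε > 0,
    MapsTo (IccExtend zero_le_one curve) (Icc (max 0 (t - ε)) (min 1 (t + ε)))
      (extChartAt 𝓘(ℝ, E) (IccExtend zero_le_one curve t)).source ∧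
    AbsolutelyContinuousOnInterval
      (fun s : ℝ ↦ extChartAt 𝓘(ℝ, E) (IccExtend zero_le_one curve t)
        (IccExtend zero_le_one curve s))
      (max 0 (t - ε)) (min 1 (t + ε))

namespace ACCurve

variable {E : Type*} [NormedAddCommGroup E] [NormedSpace ℝ E]
  {G : Type*} [TopologicalSpace G] [ChartedSpace E G]

/-- The curve as a function of a real time, constant on `(-∞, 0]` and on `[1, ∞)`. -/
def extend (α : ACCurve E G) : ℝ → G := IccExtend zero_le_one α.curve

/-- The velocity `α'(t)`, a tangent vector of `G` at `α t`. -/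
def velocity (α : ACCurve E G) (t : ℝ) : TangentSpace 𝓘(ℝ, E) (α.extend t) :=
  mfderiv 𝓘(ℝ, ℝ) 𝓘(ℝ, E) α.extend t (1 : ℝ)

end ACCurve

/-- Left translation by `g⁻¹` as a map from the tangent space at `g` to the Lie algebra
`𝔤 = T_1 G` (which is `GroupLieAlgebra 𝓘(ℝ, E) G`). The derivative of `x ↦ g⁻¹ * x` at `g` takes
values in the tangent space at `g⁻¹ * g`, and this point is equal to `1`. -/
def toLieAlgebra {E : Type*} [NormedAddCommGroup E] [NormedSpace ℝ E]
    {G : Type*} [TopologicalSpace G] [ChartedSpace E G] [Group G]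
    (g : G) (v : TangentSpace 𝓘(ℝ, E) g) : TangentSpace 𝓘(ℝ, E) (1 : G) :=
  mfderiv 𝓘(ℝ, E) 𝓘(ℝ, E) (fun x : G ↦ g⁻¹ * x) g v

open Classical in
/-- The square root velocity function `q(t) = L_{α(t)⁻¹} (α'(t) / √‖α'(t)‖)` of a curve, with
`q(t) = 0` where `α'(t) = 0`. The norm is that of the Riemannian metric at `α(t)`. -/
def srvFun {E : Type*} [NormedAddCommGroup E] [NormedSpace ℝ E]
    {G : Type*} [TopologicalSpace G] [ChartedSpace E G] [Group G]
    [RiemannianBundle (fun x : G ↦ TangentSpace 𝓘(ℝ, E) x)]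
    (α : ACCurve E G) (t : ℝ) : TangentSpace 𝓘(ℝ, E) (1 : G) :=
  if α.velocity t = 0 then 0
  else toLieAlgebra (α.extend t) ((Real.sqrt ‖α.velocity t‖)⁻¹ • α.velocity t)

/-- The Lebesgue measure on `[0,1]`. -/
def intervalMeasure : Measure ℝ := volume.restrict (Icc (0 : ℝ) 1)

/-- The space `L²([0,1], 𝔤)`, with the norm on the Lie algebra `𝔤 = T_1 G` that is given by the
Riemannian metric at the identity. -/
abbrev L2LieAlgebra (E : Type*) [NormedAddCommGroup E] [NormedSpace ℝ E]
    (G : Type*) [TopologicalSpace G] [ChartedSpace E G] [Group G]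
    [RiemannianBundle (fun x : G ↦ TangentSpace 𝓘(ℝ, E) x)] : Type _ :=
  Lp (TangentSpace 𝓘(ℝ, E) (1 : G)) 2 intervalMeasure

/-- The square root velocity map `Q(α) = (α(0), q)`, where `h` says that the square root velocity
functions are square integrable, so that they define elements of `L²([0,1], 𝔤)`. -/
def srvMap {E : Type*} [NormedAddCommGroup E] [NormedSpace ℝ E]
    {G : Type*} [TopologicalSpace G] [ChartedSpace E G] [Group G]
    [RiemannianBundle (fun x : G ↦ TangentSpace 𝓘(ℝ, E) x)]
    (h : ∀ α : ACCurve E G, MemLp (srvFun α) 2 intervalMeasure)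
    (α : ACCurve E G) : G × L2LieAlgebra E G :=
  (α.curve 0, (h α).toLp (srvFun α))

/-- The curve `α` solves `α(0) = α₀` and `α'(t) = L_{α(t)} (‖q(t)‖ q(t))` for almost every `t` in
`[0,1]`. Here `mulInvariantVectorField v g` is the left translate `L_g v` of `v ∈ 𝔤`. -/
def SolvesSRVEquation {E : Type*} [NormedAddCommGroup E] [NormedSpace ℝ E]
    {G : Type*} [TopologicalSpace G] [ChartedSpace E G] [Group G]
    [RiemannianBundle (fun x : G ↦ TangentSpace 𝓘(ℝ, E) x)]
    (α : ACCurve E G) (α₀ : G) (q : L2LieAlgebra E G) : Prop :=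
  α.curve 0 = α₀ ∧ ∀ᵐ t ∂intervalMeasure,
    HasMFDerivAt 𝓘(ℝ, ℝ) 𝓘(ℝ, E) α.extend t
      ((1 : ℝ →L[ℝ] ℝ).smulRight
        (mulInvariantVectorField (I := 𝓘(ℝ, E)) (‖q t‖ • q t) (α.extend t)))

end

/-! On a normed space `w ↦ w / √‖w‖` and `q ↦ ‖q‖ q` are mutually inverse, and `‖q‖² = ‖w‖` for
corresponding vectors. A left-invariant metric gives `α'(t)` and the logarithmic derivative `w = α⁻¹
α'` the same norm, so `q_α` is square integrable exactly when `w` is integrable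
(`norm_inv_sqrt_norm_smul_sq`, `ACCurve.srvFun_eq`). It remains to see that an absolutely continuous
curve has an integrable logarithmic derivative, and that this together with the starting point can
be prescribed and determines the curve.

Read in the chart `φ` at the identity, `x(s) = φ(α(t)⁻¹ α(s))` satisfies `x' = F(x) w` almost
everywhere near `t`, where `F` is `leftFrame`: a `C¹` field of operators near `φ(1)` with `F(φ(1)) =
id`. Hence `w = F(x)⁻¹ x'` is integrable near `t`, and by compactness on `[0,1]`
(`ACCurve.integrableOn_logDeriv`).

Uniqueness: `F` is Lipschitz near `φ(1)`, so two solutions that agree at `t` agree just after `t`.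
In a Hausdorff group the agreement set is closed, and it exhausts `[0,1]`
(`ACCurve.eq_of_hasLogDerivAt`).

Existence: a fixed point argument solves the equation from the identity for controls of mass at most
some `η`. By left invariance the same `η` serves at every starting point, so `[0,1]` splits into
finitely many short intervals whose solutions are multiplied together (`exists_isStoppedSolution`).
-/

open Filter Topology
open scoped NNReal

/-! ### Absolutely continuous functions with values in a finite-dimensional space -/

section AbsoluteContinuity

namespace AbsolutelyContinuousOnInterval

variable {X Y : Type*} [PseudoMetricSpace X] [PseudoMetricSpace Y] {a b : ℝ}

/-- Each sum of increments of `f` is dominated by `C` times that of `g`. This comparison also yields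
the Lipschitz and vector-valued cases. -/
theorem of_dist_le {f : ℝ → X} {g : ℝ → Y} (hg : AbsolutelyContinuousOnInterval g a b) (C : ℝ)
    (h : ∀ s ∈ uIcc a b, ∀ t ∈ uIcc a b, dist (f s) (f t) ≤ C * dist (g s) (g t)) :
    AbsolutelyContinuousOnInterval f a b := by
  have h0 : Tendsto (fun E : ℕ × (ℕ → ℝ × ℝ) ↦
      C * ∑ i ∈ Finset.range E.1, dist (g (E.2 i).1) (g (E.2 i).2))
      (totalLengthFilter ⊓ 𝓟 (disjWithin a b)) (𝓝 0) := by
    simpa using Tendsto.const_mul C hg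
  refine squeeze_zero' (.of_forall fun _ ↦ Finset.sum_nonneg fun _ _ ↦ dist_nonneg) ?_ h0
  filter_upwards [mem_inf_of_right (mem_principal_self _)] with E hE
  rw [Finset.mul_sum]
  exact Finset.sum_le_sum fun i hi ↦ h _ (hE.1 i hi).1 _ (hE.1 i hi).2

theorem congr {f g : ℝ → X} (hf : AbsolutelyContinuousOnInterval f a b)
    (h : EqOn f g (uIcc a b)) : AbsolutelyContinuousOnInterval g a b :=
  hf.of_dist_le 1 fun s hs t ht ↦ by rw [h hs, h ht, one_mul]

theorem prodMk {f : ℝ → X} {g : ℝ → Y} (hf : AbsolutelyContinuousOnInterval f a b)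
    (hg : AbsolutelyContinuousOnInterval g a b) :
    AbsolutelyContinuousOnInterval (fun t ↦ (f t, g t)) a b := by
  refine squeeze_zero (fun _ ↦ Finset.sum_nonneg fun _ _ ↦ dist_nonneg) (fun E ↦ ?_)
    (by simpa using Tendsto.add hf hg)
  rw [← Finset.sum_add_distrib]
  exact Finset.sum_le_sum fun i _ ↦
    max_le (le_add_of_nonneg_right dist_nonneg) (le_add_of_nonneg_left dist_nonneg)

theorem comp_lipschitzOnWith {f : ℝ → X} (hf : AbsolutelyContinuousOnInterval f a b) {K : ℝ≥0}
    {s : Set X} {g : X → Y} (hg : LipschitzOnWith K g s) (hs : MapsTo f (uIcc a b) s) :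
    AbsolutelyContinuousOnInterval (fun t ↦ g (f t)) a b :=
  hf.of_dist_le K fun _ hx _ hy ↦ hg.dist_le_mul _ (hs hx) _ (hs hy)

end AbsolutelyContinuousOnInterval

variable {E : Type*} [NormedAddCommGroup E] [NormedSpace ℝ E] {a b : ℝ}

theorem IntervalIntegrable.absolutelyContinuousOnInterval {u : ℝ → E}
    (hu : IntervalIntegrable u volume a b) :
    AbsolutelyContinuousOnInterval (fun t ↦ ∫ s in a..t, u s) a b := by
  have hI : ∀ s ∈ uIcc a b, IntervalIntegrable u volume a s := fun s hs ↦
    hu.mono_set (uIcc_subset_uIcc_left hs)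
  refine (hu.norm.absolutelyContinuousOnInterval_intervalIntegral left_mem_uIcc).of_dist_le 1
    fun s hs t ht ↦ ?_
  rw [dist_eq_norm, dist_eq_norm,
    intervalIntegral.integral_interval_sub_left (hI s hs) (hI t ht),
    intervalIntegral.integral_interval_sub_left (hI s hs).norm (hI t ht).norm, one_mul]
  exact intervalIntegral.norm_integral_le_abs_integral_norm

namespace AbsolutelyContinuousOnInterval

variable [FiniteDimensional ℝ E]

theorem ae_differentiableAt' {f : ℝ → E} (hf : AbsolutelyContinuousOnInterval f a b) :
    ∀ᵐ t : ℝ, t ∈ uIcc a b → DifferentiableAt ℝ f t :=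
  hf.boundedVariationOn.ae_differentiableAt_of_mem_uIcc

/-- Coordinates in a basis reduce this to real-valued functions. -/
theorem intervalIntegrable_deriv' {f : ℝ → E} (hf : AbsolutelyContinuousOnInterval f a b) :
    IntervalIntegrable (deriv f) volume a b := by
  let B := Module.finBasis ℝ E
  let c i : E →L[ℝ] ℝ := LinearMap.toContinuousLinearMap (B.coord i)
  have hi i : IntervalIntegrable (fun t ↦ deriv (fun s ↦ c i (f s)) t • B i) volume a b := by
    have h1 := (hf.comp_lipschitzOnWith (s := univ) (c i).lipschitz.lipschitzOnWith
      (mapsTo_univ _ _)).intervalIntegrable_deriv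
    exact ⟨h1.1.smul_const _, h1.2.smul_const _⟩
  refine (IntervalIntegrable.sum Finset.univ fun i _ ↦ hi i).congr_ae ?_
  rw [EventuallyEq, ae_restrict_iff' measurableSet_uIoc]
  filter_upwards [hf.ae_differentiableAt'] with t ht hm
  have hd := (ht (uIoc_subset_uIcc hm)).hasDerivAt
  rw [Finset.sum_apply]
  conv_rhs => rw [← B.sum_repr (deriv f t)]
  refine Finset.sum_congr rfl fun i _ ↦ ?_
  have h1 : HasDerivAt (fun s ↦ c i (f s)) (c i (deriv f t)) t :=
    (c i).hasFDerivAt.comp_hasDerivAt t hd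
  rw [h1.deriv]
  rfl

/-- Subtracting the primitive of `u` leaves an absolutely continuous function with derivative zero
almost everywhere, hence a constant. -/
theorem eq_add_integral {f u : ℝ → E} (hab : a ≤ b) (hf : AbsolutelyContinuousOnInterval f a b)
    (hu : IntervalIntegrable u volume a b)
    (h : ∀ᵐ t : ℝ, t ∈ Icc a b → HasDerivAt f (u t) t) {t : ℝ} (ht : t ∈ Icc a b) :
    f t = f a + ∫ s in a..t, u s := by
  have : CompleteSpace E := FiniteDimensional.complete ℝ E
  obtain ⟨C, hC⟩ := (hf.sub hu.absolutelyContinuousOnInterval).const_of_ae_hasDerivAt_zero (by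
    filter_upwards [h, hu.ae_hasDerivAt_integral] with s hs hs' hm
    have := (hs (by rwa [uIcc_of_le hab] at hm)).sub (hs' hm a left_mem_uIcc)
    rwa [sub_self] at this)
  rw [uIcc_of_le hab] at hC
  have h1 := hC a (left_mem_Icc.2 hab)
  have h2 := hC t ht
  simp only [Pi.sub_apply, intervalIntegral.integral_same, sub_zero] at h1 h2
  rw [h1, ← h2]; abel

end AbsolutelyContinuousOnInterval

end AbsoluteContinuity

/-! ### Carathéodory equations `x' = F(x) u` in a Banach space -/

section Caratheodory

variable {E : Type*} [NormedAddCommGroup E] [NormedSpace ℝ E]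

theorem AEStronglyMeasurable.clm_apply_of_continuous {F : ℝ → E →L[ℝ] E} {u : ℝ → E}
    {μ : Measure ℝ} (hF : AEStronglyMeasurable F μ) (hu : AEStronglyMeasurable u μ) :
    AEStronglyMeasurable (fun t ↦ F t (u t)) μ :=
  isBoundedBilinearMap_apply.continuous.comp_aestronglyMeasurable (hF.prodMk hu)

/-- The Carathéodory equation `x' = F(x) u` with integrable control `u` of small mass has a
solution that stays in the ball on which `F` is bounded and Lipschitz. -/
theorem exists_caratheodory_solution [CompleteSpace E] {F : E → E →L[ℝ] E} {x₀ : E} {r M : ℝ}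
    (hr : 0 ≤ r) {K : ℝ≥0} (hK : LipschitzOnWith K F (Metric.closedBall x₀ r))
    (hM : ∀ x ∈ Metric.closedBall x₀ r, ‖F x‖ ≤ M) {u : ℝ → E} (hu : Integrable u) (c : ℝ)
    (hKu : K * ∫ t, ‖u t‖ ≤ 1 / 2) (hMu : M * ∫ t, ‖u t‖ ≤ r) :
    ∃ x : ℝ → E, Continuous x ∧ (∀ t, x t ∈ Metric.closedBall x₀ r) ∧
      Integrable (fun s ↦ F (x s) (u s)) ∧ ∀ t, x t = x₀ + ∫ s in c..t, F (x s) (u s) := by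
  set B := Metric.closedBall x₀ r
  have hI : ∀ x : ℝ → E, Continuous x → (∀ t, x t ∈ B) →
      Integrable (fun s ↦ F (x s) (u s)) := fun x hx hB ↦ by
    refine (hu.norm.const_mul M).mono' ?_ (.of_forall fun t ↦ ?_)
    · exact AEStronglyMeasurable.clm_apply_of_continuous
        (hK.continuousOn.comp_continuous hx hB).aestronglyMeasurable hu.1
    · exact ((F (x t)).le_opNorm _).trans (by gcongr; exact hM _ (hB t))
  have hT : ∀ x : ℝ → E, Continuous x → (∀ t, x t ∈ B) → ∀ t,
      x₀ + ∫ s in c..t, F (x s) (u s) ∈ B := fun x hx hB t ↦ by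
    rw [mem_closedBall_iff_norm, add_sub_cancel_left]
    refine intervalIntegral.norm_integral_le_integral_norm_uIoc.trans ?_
    refine (setIntegral_le_integral (hI x hx hB).norm (.of_forall fun _ ↦ norm_nonneg _)).trans ?_
    refine le_trans ?_ hMu
    rw [← integral_const_mul]
    refine integral_mono (hI x hx hB).norm (hu.norm.const_mul M) fun t ↦ ?_
    exact ((F (x t)).le_opNorm _).trans (by gcongr; exact hM _ (hB t))
  have hcont : ∀ x : ℝ → E, Continuous x → (∀ t, x t ∈ B) →
      Continuous fun t ↦ x₀ + ∫ s in c..t, F (x s) (u s) := fun x hx hB ↦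
    continuous_const.add (intervalIntegral.continuous_primitive
      (fun _ _ ↦ (hI x hx hB).intervalIntegrable) c)
  -- The Picard operator on continuous curves in the ball, with the sup metric. As `u` is integrable
  -- over all of `ℝ`, no time interval has to be fixed.
  let T : (BoundedContinuousFunction ℝ B) → (BoundedContinuousFunction ℝ B) := fun x ↦
    BoundedContinuousFunction.mkOfBound
      ⟨fun t ↦ ⟨x₀ + ∫ s in c..t, F (x s) (u s),
        hT (fun s ↦ x s) (continuous_subtype_val.comp x.continuous) (fun s ↦ (x s).2) t⟩,
        (hcont (fun s ↦ x s) (continuous_subtype_val.comp x.continuous)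
          (fun s ↦ (x s).2)).subtype_mk _⟩ (r + r)
      fun s t ↦ dist_triangle_right _ _ x₀ |>.trans
        (add_le_add (Metric.mem_closedBall.1 (Subtype.prop _))
          (Metric.mem_closedBall.1 (Subtype.prop _)))
  -- The Lipschitz constant is `K * ∫ ‖u‖`, at most `1 / 2` by `hKu`.
  have hcontr : ContractingWith (1 / 2) T := by
    refine ⟨by norm_num, LipschitzWith.of_dist_le_mul fun x y ↦ ?_⟩
    refine (BoundedContinuousFunction.dist_le (by positivity)).2 fun t ↦ ?_
    have hx := hI (fun s ↦ x s) (continuous_subtype_val.comp x.continuous) (fun s ↦ (x s).2)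
    have hy := hI (fun s ↦ y s) (continuous_subtype_val.comp y.continuous) (fun s ↦ (y s).2)
    change dist (x₀ + ∫ s in c..t, F (x s) (u s)) (x₀ + ∫ s in c..t, F (y s) (u s)) ≤ _
    rw [dist_add_left, dist_eq_norm,
      ← intervalIntegral.integral_sub hx.intervalIntegrable hy.intervalIntegrable]
    refine intervalIntegral.norm_integral_le_integral_norm_uIoc.trans ?_
    refine (setIntegral_le_integral (hx.sub hy).norm (.of_forall fun _ ↦ norm_nonneg _)).trans ?_
    calc ∫ s, ‖F (x s) (u s) - F (y s) (u s)‖ ≤ ∫ s, (K * dist x y) * ‖u s‖ := by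
          refine integral_mono (hx.sub hy).norm (hu.norm.const_mul _) fun s ↦ ?_
          dsimp only
          rw [← sub_apply]
          refine ((F (x s) - F (y s)).le_opNorm _).trans ?_
          gcongr
          rw [← dist_eq_norm]
          refine (hK.dist_le_mul _ (x s).2 _ (y s).2).trans ?_
          gcongr
          exact BoundedContinuousFunction.dist_coe_le_dist (f := x) (g := y) s
      _ = (K * ∫ s, ‖u s‖) * dist x y := by rw [integral_const_mul]; ring
      _ ≤ _ := by
        gcongr
        simpa using hKu
  have : Nonempty B := ⟨⟨x₀, Metric.mem_closedBall_self hr⟩⟩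
  have : CompleteSpace B := Metric.isClosed_closedBall.completeSpace_coe
  have : Nonempty (BoundedContinuousFunction ℝ B) :=
    ⟨BoundedContinuousFunction.const _ (Classical.arbitrary B)⟩
  let x := ContractingWith.fixedPoint T hcontr
  have hfix : T x = x := hcontr.fixedPoint_isFixedPt
  have hxc : Continuous fun t ↦ (x t : E) := continuous_subtype_val.comp x.continuous
  refine ⟨fun t ↦ x t, hxc, fun t ↦ (x t).2, hI _ hxc fun t ↦ (x t).2, fun t ↦ ?_⟩
  conv_lhs => rw [← hfix]
  rfl

/-- Where `‖x - y‖` is maximal, the integral equations bound it by half of itself, so it vanishes.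
-/
theorem eqOn_of_caratheodory_solution {F : E → E →L[ℝ] E} {s : Set E} {K : ℝ≥0} {a b : ℝ}
    (hK : LipschitzOnWith K F s) {u x y : ℝ → E} (hu : IntervalIntegrable u volume a b)
    (hab : a ≤ b) (hKu : K * ∫ t in a..b, ‖u t‖ ≤ 1 / 2)
    (hxc : ContinuousOn x (Icc a b)) (hyc : ContinuousOn y (Icc a b))
    (hxs : MapsTo x (Icc a b) s) (hys : MapsTo y (Icc a b) s)
    (hx : ∀ t ∈ Icc a b, x t = x a + ∫ τ in a..t, F (x τ) (u τ))
    (hy : ∀ t ∈ Icc a b, y t = y a + ∫ τ in a..t, F (y τ) (u τ))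
    (hxi : IntervalIntegrable (fun τ ↦ F (x τ) (u τ)) volume a b)
    (hyi : IntervalIntegrable (fun τ ↦ F (y τ) (u τ)) volume a b)
    (h : x a = y a) : EqOn x y (Icc a b) := by
  obtain ⟨t₀, ht₀, hmax⟩ := isCompact_Icc.exists_isMaxOn (nonempty_Icc.2 hab) (hxc.sub hyc).norm
  have key : ‖x t₀ - y t₀‖ ≤ 1 / 2 * ‖x t₀ - y t₀‖ := by
    have hsub : uIcc a t₀ ⊆ uIcc a b := by
      rw [uIcc_of_le ht₀.1, uIcc_of_le hab]; exact Icc_subset_Icc le_rfl ht₀.2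
    calc ‖x t₀ - y t₀‖ = ‖∫ τ in a..t₀, (F (x τ) (u τ) - F (y τ) (u τ))‖ := by
          rw [intervalIntegral.integral_sub (hxi.mono_set hsub) (hyi.mono_set hsub), hx t₀ ht₀,
            hy t₀ ht₀, h, add_sub_add_left_eq_sub]
      _ ≤ ∫ τ in a..t₀, (K * ‖x t₀ - y t₀‖) * ‖u τ‖ := by
          refine intervalIntegral.norm_integral_le_of_norm_le ht₀.1 (.of_forall fun τ hτ ↦ ?_)
            ((hu.norm.const_mul _).mono_set hsub)
          have hτ' : τ ∈ Icc a b := ⟨hτ.1.le, hτ.2.trans ht₀.2⟩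
          rw [← sub_apply]
          refine ((F (x τ) - F (y τ)).le_opNorm _).trans ?_
          gcongr
          rw [← dist_eq_norm]
          refine (hK.dist_le_mul _ (hxs hτ') _ (hys hτ')).trans ?_
          gcongr
          rw [dist_eq_norm]
          exact hmax hτ'
      _ ≤ (K * ∫ τ in a..b, ‖u τ‖) * ‖x t₀ - y t₀‖ := by
          rw [intervalIntegral.integral_const_mul, mul_right_comm]
          gcongr
          refine intervalIntegral.integral_mono_interval le_rfl ht₀.1 ht₀.2
            (.of_forall fun _ ↦ norm_nonneg _) hu.norm
      _ ≤ _ := by gcongr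
  have h0 : ‖x t₀ - y t₀‖ ≤ 0 := by linarith
  intro t ht
  have := (hmax ht).trans h0
  simpa [sub_eq_zero] using this

end Caratheodory

/-! ### Left translations read in the chart at the identity -/

section LeftFrame

variable {E : Type*} [NormedAddCommGroup E] [NormedSpace ℝ E]
  {G : Type*} [TopologicalSpace G] [ChartedSpace E G]

theorem contMDiffAt_extChartAt_symm [IsManifold 𝓘(ℝ, E) ∞ G] (p : G) {x : E}
    (hx : x ∈ (extChartAt 𝓘(ℝ, E) p).target) :
    ContMDiffAt 𝓘(ℝ, E) 𝓘(ℝ, E) ∞ (extChartAt 𝓘(ℝ, E) p).symm x :=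
  (contMDiffOn_extChartAt_symm p).contMDiffAt ((isOpen_extChartAt_target p).mem_nhds hx)

theorem hasMFDerivAt_extChartAt_symm_self [IsManifold 𝓘(ℝ, E) ∞ G] (p : G) :
    HasMFDerivAt 𝓘(ℝ, E) 𝓘(ℝ, E) (extChartAt 𝓘(ℝ, E) p).symm (extChartAt 𝓘(ℝ, E) p p)
      (ContinuousLinearMap.id ℝ E) := by
  have : IsManifold 𝓘(ℝ, E) 1 G := .of_le (n := ∞) (by simp)
  have h := ((contMDiffAt_extChartAt_symm p
    (mem_extChartAt_target (I := 𝓘(ℝ, E)) p)).mdifferentiableAt (by simp)).hasMFDerivAt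
  have h' := mfderivWithin_range_extChartAt_symm (I := 𝓘(ℝ, E)) (x := p)
  rw [modelWithCornersSelf_coe, range_id, mfderivWithin_univ] at h'
  rw [h'] at h
  exact h

variable [Group G]

variable (E G) in
/-- The differentials at the identity of the left translations of a Lie group, read in the
preferred chart at the identity. -/
noncomputable def leftFrame (x : E) : E →L[ℝ] E :=
  fderiv ℝ (fun y ↦ extChartAt 𝓘(ℝ, E) (1 : G)
    ((extChartAt 𝓘(ℝ, E) (1 : G)).symm x * (extChartAt 𝓘(ℝ, E) (1 : G)).symm y))
    (extChartAt 𝓘(ℝ, E) (1 : G) 1)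

theorem leftFrame_one :
    leftFrame E G (extChartAt 𝓘(ℝ, E) (1 : G) 1) = ContinuousLinearMap.id ℝ E := by
  have h : (fun y ↦ extChartAt 𝓘(ℝ, E) (1 : G)
      ((extChartAt 𝓘(ℝ, E) (1 : G)).symm (extChartAt 𝓘(ℝ, E) (1 : G) 1) *
        (extChartAt 𝓘(ℝ, E) (1 : G)).symm y)) =ᶠ[𝓝 (extChartAt 𝓘(ℝ, E) (1 : G) 1)] id := by
    filter_upwards [extChartAt_target_mem_nhds (I := 𝓘(ℝ, E)) (1 : G)] with y hy
    rw [extChartAt_to_inv, one_mul, PartialEquiv.right_inv _ hy, id]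
  rw [leftFrame, h.fderiv_eq, fderiv_id]

variable [LieGroup 𝓘(ℝ, E) ∞ G]

/-- A partial derivative of the smooth multiplication depends smoothly on the parameter. This
supplies the local Lipschitz bound for the equation. -/
theorem contDiffAt_leftFrame : ContDiffAt ℝ 1 (leftFrame E G) (extChartAt 𝓘(ℝ, E) (1 : G) 1) := by
  set φ := extChartAt 𝓘(ℝ, E) (1 : G) with hφ
  have hs : ContMDiffAt 𝓘(ℝ, E) 𝓘(ℝ, E) ∞ φ.symm (φ 1) :=
    contMDiffAt_extChartAt_symm _ (mem_extChartAt_target _)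
  have h1 : φ.symm (φ 1) = 1 := extChartAt_to_inv _
  have hm : ContMDiffAt 𝓘(ℝ, E × E) 𝓘(ℝ, E) ∞ (fun z : E × E ↦ φ.symm z.1 * φ.symm z.2)
      (φ 1, φ 1) :=
    (ContMDiffAt.comp (φ 1, φ 1) (g := φ.symm) hs contDiff_fst.contMDiff.contMDiffAt).mul
      (ContMDiffAt.comp (φ 1, φ 1) (g := φ.symm) hs contDiff_snd.contMDiff.contMDiffAt)
  have hc : ContMDiffAt 𝓘(ℝ, E × E) 𝓘(ℝ, E) ∞ (fun z : E × E ↦ φ (φ.symm z.1 * φ.symm z.2))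
      (φ 1, φ 1) := by
    refine ContMDiffAt.comp (φ 1, φ 1) (g := φ) ?_ hm
    rw [h1, one_mul]
    exact contMDiffAt_extChartAt
  exact ContDiffAt.fderiv (n := ∞) (f := fun x y ↦ φ (φ.symm x * φ.symm y)) (g := fun _ ↦ φ 1)
    hc.contDiffAt contDiffAt_const (by norm_cast)

theorem hasMFDerivAt_mul_left (g h : G) :
    HasMFDerivAt 𝓘(ℝ, E) 𝓘(ℝ, E) (fun x : G ↦ g * x) h
      (mfderiv 𝓘(ℝ, E) 𝓘(ℝ, E) (fun x : G ↦ g * x) h) :=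
  ((contMDiff_mul_left (n := ∞)).contMDiffAt.mdifferentiableAt (by simp)).hasMFDerivAt

theorem mdifferentiableAt_extChartAt_of_mem {p h : G}
    (hh : h ∈ (extChartAt 𝓘(ℝ, E) p).source) :
    MDifferentiableAt 𝓘(ℝ, E) 𝓘(ℝ, E) (extChartAt 𝓘(ℝ, E) p) h :=
  (contMDiffAt_extChartAt' (n := ∞) (by simpa using hh)).mdifferentiableAt (by simp)

/-- The chart at `1` is the one that identifies the tangent space at `1` with `E`, so the coordinate
derivative and the manifold derivative are the same operator. -/
theorem hasMFDerivAt_extChartAt_mul_left {h : G}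
    (hh : h ∈ (extChartAt 𝓘(ℝ, E) (1 : G)).source) :
    HasMFDerivAt 𝓘(ℝ, E) 𝓘(ℝ, E) (fun y : G ↦ extChartAt 𝓘(ℝ, E) (1 : G) (h * y)) 1
      (leftFrame E G (extChartAt 𝓘(ℝ, E) (1 : G) h)) := by
  set φ := extChartAt 𝓘(ℝ, E) (1 : G) with hφ
  have h1 : φ.symm (φ 1) = 1 := extChartAt_to_inv _
  have hd : MDifferentiableAt 𝓘(ℝ, E) 𝓘(ℝ, E) (fun y : G ↦ φ (h * y)) 1 := by
    refine MDifferentiableAt.comp (1 : G) (g := φ) ?_ (hasMFDerivAt_mul_left h 1).mdifferentiableAt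
    rw [mul_one]; exact mdifferentiableAt_extChartAt_of_mem hh
  have hd' := hd.hasMFDerivAt
  have hd'' : HasMFDerivAt 𝓘(ℝ, E) 𝓘(ℝ, E) (fun y : G ↦ φ (h * y)) (φ.symm (φ 1))
      (mfderiv 𝓘(ℝ, E) 𝓘(ℝ, E) (fun y : G ↦ φ (h * y)) 1) := by rw [h1]; exact hd'
  let D : E →L[ℝ] E := mfderiv 𝓘(ℝ, E) 𝓘(ℝ, E) (fun y : G ↦ φ (h * y)) 1
  have h2 : HasFDerivAt (fun y : E ↦ φ (h * φ.symm y)) D (φ 1) :=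
    hasMFDerivAt_iff_hasFDerivAt.1
      (HasMFDerivAt.comp (φ 1) hd'' (hasMFDerivAt_extChartAt_symm_self (1 : G)))
  rw [leftFrame, ← hφ, φ.left_inv hh]
  exact HasMFDerivAt.congr_mfderiv hd' h2.fderiv.symm

/-- Carries a solution from the chart to the group. The factor `g` is free because logarithmic
derivatives ignore left translation. -/
theorem HasMFDerivAt.mul_left_extChartAt_symm {x : ℝ → E} {t : ℝ} {v : E} (g : G)
    (hx : x t ∈ (extChartAt 𝓘(ℝ, E) (1 : G)).target)
    (h : HasDerivAt x (leftFrame E G (x t) v) t) :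
    HasMFDerivAt 𝓘(ℝ, ℝ) 𝓘(ℝ, E) (fun s ↦ g * (extChartAt 𝓘(ℝ, E) (1 : G)).symm (x s)) t
      ((1 : ℝ →L[ℝ] ℝ).smulRight (mulInvariantVectorField (I := 𝓘(ℝ, E)) v
        (g * (extChartAt 𝓘(ℝ, E) (1 : G)).symm (x t)))) := by
  set φ := extChartAt 𝓘(ℝ, E) (1 : G) with hφ
  set k := φ.symm (x t) with hk
  have hks : k ∈ φ.source := φ.map_target hx
  have hφk : φ k = x t := φ.right_inv hx
  have h1 := hasMFDerivAt_extChartAt_mul_left hks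
  rw [← hφ, hφk] at h1
  have h2 : MDifferentiableAt 𝓘(ℝ, E) 𝓘(ℝ, E) (fun y ↦ g * φ.symm y) (x t) :=
    ((contMDiff_mul_left (n := ∞)).contMDiffAt.comp (x t)
      (contMDiffAt_extChartAt_symm (1 : G) hx)).mdifferentiableAt (by simp)
  have h3 := h2.hasMFDerivAt
  have h4 : HasMFDerivAt 𝓘(ℝ, E) 𝓘(ℝ, E) (fun y ↦ g * φ.symm y) (φ (k * 1))
      (mfderiv 𝓘(ℝ, E) 𝓘(ℝ, E) (fun y ↦ g * φ.symm y) (x t)) := by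
    rw [mul_one, hφk]; exact h3
  have h5 := HasMFDerivAt.comp (1 : G) h4 h1
  -- The chart cancels near `1`, so the derivative of `g * φ.symm` undoes `leftFrame` up to left
  -- translation by `g * k`.
  have h6 : (fun y ↦ g * φ.symm y) ∘ (fun y ↦ φ (k * y)) =ᶠ[𝓝 1] fun y ↦ (g * k) * y := by
    have : IsTopologicalGroup G := topologicalGroup_of_lieGroup 𝓘(ℝ, E) ∞
    have : Tendsto (fun y ↦ k * y) (𝓝 1) (𝓝 k) := by
      simpa using (continuous_const_mul k).tendsto 1
    filter_upwards [this.eventually (extChartAt_source_mem_nhds' hks)] with y hy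
    simp only [Function.comp_apply, φ.left_inv hy, mul_assoc]
  have h7 := h6.mfderiv_eq (I := 𝓘(ℝ, E)) (I' := 𝓘(ℝ, E))
  rw [h5.mfderiv] at h7
  have h8 := HasMFDerivAt.comp t h3 h.hasFDerivAt.hasMFDerivAt
  have h9 : (mfderiv 𝓘(ℝ, E) 𝓘(ℝ, E) (fun y ↦ g * φ.symm y) (x t) : E →L[ℝ] E)
      (leftFrame E G (x t) v) = mulInvariantVectorField (I := 𝓘(ℝ, E)) v (g * k) :=
    congrArg (fun L : E →L[ℝ] E ↦ L v) h7
  have h10 : (mfderiv 𝓘(ℝ, E) 𝓘(ℝ, E) (fun y ↦ g * φ.symm y) (x t) : E →L[ℝ] E).comp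
      (ContinuousLinearMap.toSpanSingleton ℝ (leftFrame E G (x t) v)) =
      (1 : ℝ →L[ℝ] ℝ).smulRight
        (mulInvariantVectorField (I := 𝓘(ℝ, E)) v (g * k) : E) := by
    ext
    refine (congrArg _ (one_smul ℝ _)).trans (h9.trans ?_)
    simp
  exact HasMFDerivAt.congr_mfderiv h8 h10

/-- The opposite passage, from the group to the chart. -/
theorem HasMFDerivAt.hasDerivAt_extChartAt_mul_left {α : ℝ → G} {t : ℝ} {v : E} (g : G)
    (hg : g * α t ∈ (extChartAt 𝓘(ℝ, E) (1 : G)).source)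
    (h : HasMFDerivAt 𝓘(ℝ, ℝ) 𝓘(ℝ, E) α t ((1 : ℝ →L[ℝ] ℝ).smulRight
      (mulInvariantVectorField (I := 𝓘(ℝ, E)) v (α t)))) :
    HasDerivAt (fun s ↦ extChartAt 𝓘(ℝ, E) (1 : G) (g * α s))
      (leftFrame E G (extChartAt 𝓘(ℝ, E) (1 : G) (g * α t)) v) t := by
  set φ := extChartAt 𝓘(ℝ, E) (1 : G) with hφ
  have h1 := (MDifferentiableAt.comp (α t) (g := φ) (mdifferentiableAt_extChartAt_of_mem hg)
    (hasMFDerivAt_mul_left g (α t)).mdifferentiableAt).hasMFDerivAt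
  let D : E →L[ℝ] E := mfderiv 𝓘(ℝ, E) 𝓘(ℝ, E) (φ ∘ fun x ↦ g * x) (α t)
  let w : E := mulInvariantVectorField (I := 𝓘(ℝ, E)) v (α t)
  have h2 : HasFDerivAt (fun s ↦ φ (g * α s)) (D.comp ((1 : ℝ →L[ℝ] ℝ).smulRight w)) t :=
    hasMFDerivAt_iff_hasFDerivAt.1 (HasMFDerivAt.comp (f := α) t h1 h)
  have h1' : HasMFDerivAt 𝓘(ℝ, E) 𝓘(ℝ, E) (φ ∘ fun x ↦ g * x) (α t * 1)
      (mfderiv 𝓘(ℝ, E) 𝓘(ℝ, E) (φ ∘ fun x ↦ g * x) (α t)) := by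
    rw [mul_one]; exact h1
  have h3 := HasMFDerivAt.comp (1 : G) h1' (hasMFDerivAt_mul_left (α t) 1)
  have h4 := hasMFDerivAt_extChartAt_mul_left hg
  have h5 : (φ ∘ fun x ↦ g * x) ∘ (fun x ↦ α t * x) = fun y ↦ φ (g * α t * y) := by
    ext y; simp [mul_assoc]
  rw [h5] at h3
  have h6 := hasMFDerivAt_unique h4 h3
  have h7 : leftFrame E G (φ (g * α t)) v = D w := congrArg (fun L : E →L[ℝ] E ↦ L v) h6
  rw [h7]
  simpa using h2.hasDerivAt

end LeftFrame

/-! ### Left translation of tangent vectors -/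

section Translation

variable {E : Type*} [NormedAddCommGroup E] [NormedSpace ℝ E]
  {G : Type*} [TopologicalSpace G] [ChartedSpace E G] [Group G] [LieGroup 𝓘(ℝ, E) ∞ G]

theorem toLieAlgebra_mulInvariantVectorField (g : G) (v : GroupLieAlgebra 𝓘(ℝ, E) G) :
    toLieAlgebra g (mulInvariantVectorField v g) = v := by
  have h1 : HasMFDerivAt 𝓘(ℝ, E) 𝓘(ℝ, E) (fun x : G ↦ g⁻¹ * x) (g * 1)
      (mfderiv 𝓘(ℝ, E) 𝓘(ℝ, E) (fun x : G ↦ g⁻¹ * x) g) := by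
    rw [mul_one]; exact hasMFDerivAt_mul_left _ _
  have h2 := HasMFDerivAt.comp (1 : G) h1 (hasMFDerivAt_mul_left g 1)
  have h3 : (fun x : G ↦ g⁻¹ * x) ∘ (fun x ↦ g * x) = id := by ext x; simp
  rw [h3] at h2
  exact (congrArg (fun L : E →L[ℝ] E ↦ L v) (hasMFDerivAt_unique h2 (hasMFDerivAt_id (1 : G))) :)

theorem mulInvariantVectorField_toLieAlgebra (g : G) (w : TangentSpace 𝓘(ℝ, E) g) :
    mulInvariantVectorField (toLieAlgebra g w) g = w := by
  have h1 : HasMFDerivAt 𝓘(ℝ, E) 𝓘(ℝ, E) (fun x : G ↦ g * x) (g⁻¹ * g)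
      (mfderiv 𝓘(ℝ, E) 𝓘(ℝ, E) (fun x : G ↦ g * x) 1) := by
    rw [inv_mul_cancel]; exact hasMFDerivAt_mul_left _ _
  have h2 := HasMFDerivAt.comp g h1 (hasMFDerivAt_mul_left g⁻¹ g)
  have h3 : (fun x : G ↦ g * x) ∘ (fun x ↦ g⁻¹ * x) = id := by ext x; simp
  rw [h3] at h2
  exact (congrArg (fun L : E →L[ℝ] E ↦ L w) (hasMFDerivAt_unique h2 (hasMFDerivAt_id g)) :)

omit [LieGroup 𝓘(ℝ, E) ∞ G] in
theorem norm_mulInvariantVectorField [RiemannianBundle (fun x : G ↦ TangentSpace 𝓘(ℝ, E) x)]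
    (hG : IsLeftInvariantMetric E G) (g : G) (v : TangentSpace 𝓘(ℝ, E) (1 : G)) :
    ‖mulInvariantVectorField v g‖ = ‖v‖ := by
  let N (p : G) (w : TangentSpace 𝓘(ℝ, E) p) : ℝ := ‖w‖
  -- The translated vector lives over `g * 1`, which equals `g` only propositionally, and the norm
  -- depends on the base point.
  have key : ∀ (p q : G) (_ : p = q) (w : E), N p w = N q w := by
    rintro p _ rfl w; rfl
  have h := hG g 1 v v
  rw [real_inner_self_eq_norm_sq, real_inner_self_eq_norm_sq,
    sq_eq_sq₀ (norm_nonneg _) (norm_nonneg _)] at h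
  rw [← h]
  exact key _ _ (mul_one g).symm _

end Translation

/-! ### Local absolute continuity and its independence of charts -/

section ACNear

theorem Icc_max_min_mem_nhdsWithin (t : ℝ) {ε : ℝ} (hε : 0 < ε) :
    Icc (max 0 (t - ε)) (min 1 (t + ε)) ∈ 𝓝[Icc 0 1] t := by
  rw [← Icc_inter_Icc]
  exact inter_mem self_mem_nhdsWithin
    (mem_nhdsWithin_of_mem_nhds (Icc_mem_nhds (by linarith) (by linarith)))

theorem max_sub_le_min_add {t ε : ℝ} (ht : t ∈ Icc (0 : ℝ) 1) (hε : 0 ≤ ε) :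
    max 0 (t - ε) ≤ min 1 (t + ε) :=
  max_le (le_min zero_le_one (by linarith [ht.1])) (le_min (by linarith [ht.2]) (by linarith))

theorem mem_Icc_max_min {t ε : ℝ} (ht : t ∈ Icc (0 : ℝ) 1) (hε : 0 ≤ ε) :
    t ∈ Icc (max 0 (t - ε)) (min 1 (t + ε)) :=
  ⟨max_le ht.1 (by linarith), le_min ht.2 (by linarith)⟩

theorem Icc_max_min_subset {t δ ε : ℝ} (h : δ ≤ ε) :
    Icc (max 0 (t - δ)) (min 1 (t + δ)) ⊆ Icc (max 0 (t - ε)) (min 1 (t + ε)) :=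
  Icc_subset_Icc (max_le_max le_rfl (by linarith)) (min_le_min le_rfl (by linarith))

theorem exists_Icc_max_min_subset {t : ℝ} {s : Set ℝ} (hs : s ∈ 𝓝[Icc 0 1] t) :
    ∃ ε > 0, Icc (max 0 (t - ε)) (min 1 (t + ε)) ⊆ s := by
  obtain ⟨ε, hε, h⟩ := Metric.mem_nhdsWithin_iff.1 hs
  refine ⟨ε / 2, by positivity, fun x hx ↦ h ⟨?_, ?_⟩⟩
  · simp only [mem_Icc, max_le_iff, le_min_iff] at hx
    rw [Metric.mem_ball, Real.dist_eq, abs_lt]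
    constructor <;> linarith
  · exact ⟨(le_max_left _ _).trans hx.1, hx.2.trans (min_le_left _ _)⟩

/-- `f` is absolutely continuous on a neighbourhood of `t` in `[0,1]`. -/
def ACNear {X : Type*} [PseudoMetricSpace X] (f : ℝ → X) (t : ℝ) : Prop :=
  ∃ ε > 0, AbsolutelyContinuousOnInterval f (max 0 (t - ε)) (min 1 (t + ε))

namespace ACNear

variable {X Y : Type*} [PseudoMetricSpace X] [PseudoMetricSpace Y] {t : ℝ} {f g : ℝ → X}

theorem exists_subset (hf : ACNear f t) (ht : t ∈ Icc (0 : ℝ) 1) {s : Set ℝ}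
    (hs : s ∈ 𝓝[Icc 0 1] t) :
    ∃ ε > 0, Icc (max 0 (t - ε)) (min 1 (t + ε)) ⊆ s ∧
      AbsolutelyContinuousOnInterval f (max 0 (t - ε)) (min 1 (t + ε)) := by
  obtain ⟨ε, hε, h⟩ := hf
  obtain ⟨δ, hδ, h'⟩ := exists_Icc_max_min_subset hs
  have h0 : 0 < min ε δ := lt_min hε hδ
  refine ⟨min ε δ, h0, (Icc_max_min_subset (min_le_right _ _)).trans h', h.mono ?_⟩
  rw [uIcc_of_le (max_sub_le_min_add ht h0.le), uIcc_of_le (max_sub_le_min_add ht hε.le)]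
  exact Icc_max_min_subset (min_le_left _ _)

theorem congr (hf : ACNear f t) (ht : t ∈ Icc (0 : ℝ) 1) (h : f =ᶠ[𝓝[Icc 0 1] t] g) :
    ACNear g t := by
  obtain ⟨ε, hε, h1, h2⟩ := hf.exists_subset ht h
  refine ⟨ε, hε, h2.congr ?_⟩
  rw [uIcc_of_le (max_sub_le_min_add ht hε.le)]
  exact h1

theorem continuousWithinAt {F : Type*} [NormedAddCommGroup F] {f : ℝ → F}
    (hf : ACNear f t) (ht : t ∈ Icc (0 : ℝ) 1) :
    ContinuousWithinAt f (Icc 0 1) t := by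
  obtain ⟨ε, hε, h⟩ := hf
  have h1 := h.continuousOn
  rw [uIcc_of_le (max_sub_le_min_add ht hε.le)] at h1
  have h2 : ContinuousWithinAt f (Icc (max 0 (t - ε)) (min 1 (t + ε))) t :=
    h1 t (mem_Icc_max_min ht hε.le)
  exact h2.mono_of_mem_nhdsWithin (Icc_max_min_mem_nhdsWithin t hε)

theorem prodMk {g : ℝ → Y} (hf : ACNear f t) (hg : ACNear g t) (ht : t ∈ Icc (0 : ℝ) 1) :
    ACNear (fun s ↦ (f s, g s)) t := by
  obtain ⟨ε, hε, h⟩ := hf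
  obtain ⟨δ, hδ, h1, h2⟩ := hg.exists_subset ht (Icc_max_min_mem_nhdsWithin t hε)
  refine ⟨δ, hδ, (h.mono ?_).prodMk h2⟩
  rwa [uIcc_of_le (max_sub_le_min_add ht hε.le), uIcc_of_le (max_sub_le_min_add ht hδ.le)]

/-- A `C¹` map is locally Lipschitz. This is what makes absolute continuity independent of the
chart. -/
theorem contDiffAt_comp {E E' : Type*} [NormedAddCommGroup E] [NormedSpace ℝ E]
    [NormedAddCommGroup E'] [NormedSpace ℝ E'] {f : ℝ → E'} {g : E' → E} (hf : ACNear f t)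
    (ht : t ∈ Icc (0 : ℝ) 1) (hg : ContDiffAt ℝ 1 g (f t)) : ACNear (fun s ↦ g (f s)) t := by
  obtain ⟨K, s, hs, hK⟩ := hg.exists_lipschitzOnWith
  obtain ⟨ε, hε, h1, h2⟩ := hf.exists_subset ht
    ((hf.continuousWithinAt ht).preimage_mem_nhdsWithin hs)
  refine ⟨ε, hε, h2.comp_lipschitzOnWith hK ?_⟩
  rwa [uIcc_of_le (max_sub_le_min_add ht hε.le)]

end ACNear

theorem AbsolutelyContinuousOnInterval.acNear {X : Type*} [PseudoMetricSpace X] {f : ℝ → X}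
    (hf : AbsolutelyContinuousOnInterval f 0 1) {t : ℝ} (ht : t ∈ Icc (0 : ℝ) 1) : ACNear f t := by
  refine ⟨1, one_pos, hf.mono ?_⟩
  rw [uIcc_of_le (max_sub_le_min_add ht zero_le_one), uIcc_of_le zero_le_one]
  exact Icc_subset_Icc (le_max_left _ _) (min_le_left _ _)

variable {E : Type*} [NormedAddCommGroup E] [NormedSpace ℝ E]
  {E' : Type*} [NormedAddCommGroup E'] [NormedSpace ℝ E']
  {G : Type*} [TopologicalSpace G] [ChartedSpace E G]

/-- To be absolutely continuous in the chart at `α t`, it suffices to factor near `t` through any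
smooth map, not necessarily an inverse chart. -/
theorem ACNear.extChartAt_comp [IsManifold 𝓘(ℝ, E) ∞ G] {f : ℝ → E'} {t : ℝ} (hf : ACNear f t)
    (ht : t ∈ Icc (0 : ℝ) 1)
    {Φ : E' → G} (hΦ : ContMDiffAt 𝓘(ℝ, E') 𝓘(ℝ, E) ∞ Φ (f t)) {α : ℝ → G}
    (h : α =ᶠ[𝓝[Icc 0 1] t] fun s ↦ Φ (f s)) :
    ACNear (fun s ↦ extChartAt 𝓘(ℝ, E) (α t) (α s)) t := by
  have h0 : α t = Φ (f t) := h.self_of_nhdsWithin ht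
  have h1 : ContMDiffAt 𝓘(ℝ, E') 𝓘(ℝ, E) ∞ (fun y ↦ extChartAt 𝓘(ℝ, E) (α t) (Φ y)) (f t) := by
    refine ContMDiffAt.comp (f t) (g := extChartAt 𝓘(ℝ, E) (α t)) ?_ hΦ
    rw [← h0]
    exact contMDiffAt_extChartAt
  refine (hf.contDiffAt_comp ht (h1.contDiffAt.of_le (by simp))).congr ht ?_
  filter_upwards [h] with s hs
  rw [hs]

namespace ACCurve

theorem continuous_extend (α : ACCurve E G) : Continuous α.extend :=
  α.curve.continuous.Icc_extend'

theorem extend_apply (α : ACCurve E G) {t : ℝ} (ht : t ∈ Icc (0 : ℝ) 1) :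
    α.extend t = α.curve ⟨t, ht⟩ :=
  IccExtend_of_mem _ _ ht

theorem acNear_comp [IsManifold 𝓘(ℝ, E) ∞ G] (α : ACCurve E G) {t : ℝ} (ht : t ∈ Icc (0 : ℝ) 1)
    {Ψ : G → E'} (hΨ : ContMDiffAt 𝓘(ℝ, E) 𝓘(ℝ, E') ∞ Ψ (α.extend t)) :
    ACNear (fun s ↦ Ψ (α.extend s)) t := by
  obtain ⟨ε, hε, h1, h2⟩ := α.locally_ac t ht
  change MapsTo α.extend _ (extChartAt 𝓘(ℝ, E) (α.extend t)).source at h1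
  change AbsolutelyContinuousOnInterval
    (fun s ↦ extChartAt 𝓘(ℝ, E) (α.extend t) (α.extend s)) _ _ at h2
  have h3 : ContMDiffAt 𝓘(ℝ, E) 𝓘(ℝ, E') ∞
      (fun y ↦ Ψ ((extChartAt 𝓘(ℝ, E) (α.extend t)).symm y))
      (extChartAt 𝓘(ℝ, E) (α.extend t) (α.extend t)) := by
    refine ContMDiffAt.comp _ (g := Ψ) ?_ (contMDiffAt_extChartAt_symm _ (mem_extChartAt_target _))
    rwa [extChartAt_to_inv]
  refine (ACNear.contDiffAt_comp ⟨ε, hε, h2⟩ ht (h3.contDiffAt.of_le (by simp))).congr ht ?_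
  filter_upwards [Icc_max_min_mem_nhdsWithin t hε] with s hs
  rw [PartialEquiv.left_inv _ (h1 hs)]

/-- The absolutely continuous curve that is the restriction to `[0,1]` of a continuous map
which is absolutely continuous near every time when read in charts. -/
def ofACNear (α : ℝ → G) (hc : Continuous α)
    (h : ∀ t ∈ Icc (0 : ℝ) 1, ACNear (fun s ↦ extChartAt 𝓘(ℝ, E) (α t) (α s)) t) :
    ACCurve E G where
  curve := ⟨fun t ↦ α t, hc.comp continuous_subtype_val⟩
  locally_ac t ht := by
    have he : EqOn (IccExtend zero_le_one fun s : Icc (0 : ℝ) 1 ↦ α s) α (Icc 0 1) :=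
      fun s hs ↦ IccExtend_of_mem _ _ hs
    obtain ⟨ε, hε, h1, h2⟩ := (h t ht).exists_subset ht (s := Icc 0 1 ∩
      α ⁻¹' (extChartAt 𝓘(ℝ, E) (α t)).source)
      (inter_mem self_mem_nhdsWithin (mem_nhdsWithin_of_mem_nhds
        (hc.continuousAt.preimage_mem_nhds (extChartAt_source_mem_nhds (α t)))))
    refine ⟨ε, hε, ?_, ?_⟩
    · intro s hs
      simp only [ContinuousMap.coe_mk]
      rw [he ht, he (h1 hs).1]
      exact (h1 hs).2
    · refine h2.congr ?_
      rw [uIcc_of_le (max_sub_le_min_add ht hε.le)]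
      intro s hs
      simp only [ContinuousMap.coe_mk]
      rw [he ht, he (h1 hs).1]

theorem extend_ofACNear (α : ℝ → G) (hc : Continuous α)
    (h : ∀ t ∈ Icc (0 : ℝ) 1, ACNear (fun s ↦ extChartAt 𝓘(ℝ, E) (α t) (α s)) t) :
    EqOn (ofACNear α hc h).extend α (Icc 0 1) := fun _ hs ↦ IccExtend_of_mem _ _ hs

theorem ext_of_eqOn_extend {α β : ACCurve E G} (h : EqOn α.extend β.extend (Icc 0 1)) : α = β := by
  obtain ⟨α, _⟩ := α
  obtain ⟨β, _⟩ := β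
  congr
  ext t
  have := h t.2
  rwa [extend_apply _ t.2, extend_apply _ t.2] at this

end ACCurve

end ACNear

/-! ### Differentiability almost everywhere and the logarithmic derivative -/

section Velocity

/-- A locally null set of reals is null, so almost-everywhere claims can be checked in one chart at
a time. -/
theorem ae_intervalMeasure_of_forall_nhdsWithin {p : ℝ → Prop}
    (h : ∀ t ∈ Icc (0 : ℝ) 1, ∃ s ∈ 𝓝[Icc 0 1] t, ∀ᵐ τ : ℝ, τ ∈ s → p τ) :
    ∀ᵐ t ∂intervalMeasure, p t := by
  rw [intervalMeasure, ae_restrict_iff' measurableSet_Icc, ae_iff]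
  refine measure_null_of_locally_null _ fun t ht ↦ ?_
  simp only [Classical.not_imp, mem_ofPred_eq] at ht
  obtain ⟨s, hs, h'⟩ := h t ht.1
  refine ⟨_, inter_mem (nhdsWithin_mono t (fun x hx ↦ ?_) hs) self_mem_nhdsWithin,
    measure_mono_null ?_ (ae_iff.1 h')⟩
  · simp only [Classical.not_imp, mem_ofPred_eq] at hx; exact hx.1
  · intro x hx
    simp only [Classical.not_imp, mem_ofPred_eq, mem_inter_iff] at hx ⊢
    exact ⟨hx.1, hx.2.2⟩

variable {E : Type*} [NormedAddCommGroup E] [NormedSpace ℝ E]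
  {G : Type*} [TopologicalSpace G] [ChartedSpace E G] [Group G]

namespace ACCurve

/-- The curve `s ↦ α(t)⁻¹ α(s)` read in the preferred chart at the identity. -/
noncomputable def leftCoord (α : ACCurve E G) (t s : ℝ) : E :=
  extChartAt 𝓘(ℝ, E) (1 : G) ((α.extend t)⁻¹ * α.extend s)

/-- The logarithmic derivative `α(t)⁻¹ α'(t)`. -/
noncomputable def logDeriv (α : ACCurve E G) (t : ℝ) : E :=
  toLieAlgebra (α.extend t) (α.velocity t)

theorem leftCoord_self (α : ACCurve E G) (t : ℝ) :
    α.leftCoord t t = extChartAt 𝓘(ℝ, E) (1 : G) 1 := by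
  rw [leftCoord, inv_mul_cancel]

variable [LieGroup 𝓘(ℝ, E) ∞ G]

theorem acNear_leftCoord (α : ACCurve E G) {t : ℝ} (ht : t ∈ Icc (0 : ℝ) 1) :
    ACNear (α.leftCoord t) t := by
  refine α.acNear_comp ht (Ψ := fun g ↦ extChartAt 𝓘(ℝ, E) (1 : G) ((α.extend t)⁻¹ * g)) ?_
  refine ContMDiffAt.comp _ (g := extChartAt 𝓘(ℝ, E) (1 : G)) ?_
    contMDiff_mul_left.contMDiffAt
  rw [inv_mul_cancel]
  exact contMDiffAt_extChartAt

theorem eventually_mem_source (α : ACCurve E G) (t : ℝ) :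
    ∀ᶠ s in 𝓝 t, (α.extend t)⁻¹ * α.extend s ∈ (extChartAt 𝓘(ℝ, E) (1 : G)).source := by
  have : IsTopologicalGroup G := topologicalGroup_of_lieGroup 𝓘(ℝ, E) ∞
  have h : Tendsto (fun s ↦ (α.extend t)⁻¹ * α.extend s) (𝓝 t) (𝓝 1) := by
    have := (α.continuous_extend.const_mul (α.extend t)⁻¹).tendsto t
    rwa [inv_mul_cancel] at this
  exact h.eventually (extChartAt_source_mem_nhds (I := 𝓘(ℝ, E)) (1 : G))

theorem mdifferentiableAt_of_leftCoord (α : ACCurve E G) {t s : ℝ}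
    (hs : ∀ᶠ τ in 𝓝 s, (α.extend t)⁻¹ * α.extend τ ∈ (extChartAt 𝓘(ℝ, E) (1 : G)).source)
    (hd : DifferentiableAt ℝ (α.leftCoord t) s) :
    MDifferentiableAt 𝓘(ℝ, ℝ) 𝓘(ℝ, E) α.extend s := by
  have h1 : ContMDiffAt 𝓘(ℝ, E) 𝓘(ℝ, E) ∞
      (fun y ↦ α.extend t * (extChartAt 𝓘(ℝ, E) (1 : G)).symm y) (α.leftCoord t s) :=
    contMDiff_mul_left.contMDiffAt.comp _ (contMDiffAt_extChartAt_symm (1 : G)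
      (PartialEquiv.map_source _ hs.self_of_nhds))
  refine ((h1.mdifferentiableAt (by simp)).comp s hd.mdifferentiableAt).congr_of_eventuallyEq ?_
  filter_upwards [hs] with τ hτ
  change α.extend τ = α.extend t *
    (extChartAt 𝓘(ℝ, E) (1 : G)).symm (extChartAt 𝓘(ℝ, E) (1 : G) _)
  rw [PartialEquiv.left_inv _ hτ, mul_inv_cancel_left]

theorem hasMFDerivAt_logDeriv (α : ACCurve E G) {t : ℝ}
    (h : MDifferentiableAt 𝓘(ℝ, ℝ) 𝓘(ℝ, E) α.extend t) :
    HasMFDerivAt 𝓘(ℝ, ℝ) 𝓘(ℝ, E) α.extend t ((1 : ℝ →L[ℝ] ℝ).smulRight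
      (mulInvariantVectorField (I := 𝓘(ℝ, E)) (α.logDeriv t) (α.extend t))) := by
  rw [logDeriv, mulInvariantVectorField_toLieAlgebra]
  refine h.hasMFDerivAt.congr_mfderiv ?_
  have : ∀ L : ℝ →L[ℝ] E, L = (1 : ℝ →L[ℝ] ℝ).smulRight (L 1) := fun L ↦ by ext; simp
  exact this _

theorem logDeriv_eq (α : ACCurve E G) {t : ℝ} {v : TangentSpace 𝓘(ℝ, E) (1 : G)}
    (h : HasMFDerivAt 𝓘(ℝ, ℝ) 𝓘(ℝ, E) α.extend t ((1 : ℝ →L[ℝ] ℝ).smulRight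
      (mulInvariantVectorField (I := 𝓘(ℝ, E)) v (α.extend t)))) : α.logDeriv t = v := by
  have h1 : α.velocity t = mulInvariantVectorField (I := 𝓘(ℝ, E)) v (α.extend t) := by
    rw [velocity, h.mfderiv]
    exact one_smul ℝ (mulInvariantVectorField (I := 𝓘(ℝ, E)) v (α.extend t) : E)
  rw [logDeriv, h1, toLieAlgebra_mulInvariantVectorField]

variable [FiniteDimensional ℝ E]

theorem ae_mdifferentiableAt (α : ACCurve E G) :
    ∀ᵐ t ∂intervalMeasure, MDifferentiableAt 𝓘(ℝ, ℝ) 𝓘(ℝ, E) α.extend t := by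
  refine ae_intervalMeasure_of_forall_nhdsWithin fun t ht ↦ ?_
  obtain ⟨ε, hε, h1, h2⟩ := (α.acNear_leftCoord ht).exists_subset ht
    (mem_nhdsWithin_of_mem_nhds (α.eventually_mem_source t).eventually_nhds)
  refine ⟨_, Icc_max_min_mem_nhdsWithin t hε, ?_⟩
  filter_upwards [h2.ae_differentiableAt'] with s hs hm
  rw [uIcc_of_le (max_sub_le_min_add ht hε.le)] at hs
  exact α.mdifferentiableAt_of_leftCoord (h1 hm) (hs hm)

/-- Near `t` the logarithmic derivative is `F(x)⁻¹ x'`, where `x` is `leftCoord` and `F` is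
`leftFrame`: a bounded continuous operator applied to an integrable function. -/
theorem integrableOn_logDeriv (α : ACCurve E G) :
    IntegrableOn α.logDeriv (Icc 0 1) := by
  refine LocallyIntegrableOn.integrableOn_isCompact (fun t ht ↦ ?_) isCompact_Icc
  have : CompleteSpace E := FiniteDimensional.complete ℝ E
  let e : E := extChartAt 𝓘(ℝ, E) (1 : G) 1
  let R : E → E →L[ℝ] E := fun x ↦ (leftFrame E G x).inverse
  have hR : ∀ᶠ x in 𝓝 e, (leftFrame E G x).IsInvertible ∧ ContinuousAt R x := by
    have hinv : (leftFrame E G e).IsInvertible := by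
      rw [leftFrame_one]; exact ⟨ContinuousLinearEquiv.refl ℝ E, rfl⟩
    have h0 : ∀ᶠ x in 𝓝 e, ContinuousAt (leftFrame E G) x :=
      (contDiffAt_leftFrame.eventually (by simp)).mono fun _ h ↦ h.continuousAt
    obtain ⟨N, hN⟩ := hinv
    -- Invertible operators form an open set on which inversion is continuous.
    have h2 : ∀ᶠ L : E →L[ℝ] E in 𝓝 (leftFrame E G e),
        L.IsInvertible ∧ ContinuousAt ContinuousLinearMap.inverse L := by
      rw [← hN]
      filter_upwards [N.nhds] with _ h
      exact ⟨h, (show ContinuousLinearMap.IsInvertible _ from h).contDiffAt_map_inverse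
        (n := 0) |>.continuousAt⟩
    filter_upwards [h0, contDiffAt_leftFrame.continuousAt.eventually h2] with x hx hx'
    exact ⟨hx'.1, hx'.2.comp hx⟩
  have hmem : α.leftCoord t ⁻¹' {x | (leftFrame E G x).IsInvertible ∧ ContinuousAt R x} ∈
      𝓝[Icc 0 1] t := by
    refine ((α.acNear_leftCoord ht).continuousWithinAt ht).preimage_mem_nhdsWithin ?_
    rw [leftCoord_self]
    exact hR
  obtain ⟨ε, hε, h1, h2⟩ := (α.acNear_leftCoord ht).exists_subset ht
    (inter_mem hmem (mem_nhdsWithin_of_mem_nhds (α.eventually_mem_source t)))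
  refine ⟨_, Icc_max_min_mem_nhdsWithin t hε, ?_⟩
  have hle := max_sub_le_min_add ht hε.le
  have hx := h2.continuousOn
  rw [uIcc_of_le hle] at hx
  have hRc : ContinuousOn (fun s ↦ R (α.leftCoord t s)) (Icc (max 0 (t - ε)) (min 1 (t + ε))) :=
    fun s hs ↦ ContinuousAt.comp_continuousWithinAt (h1 hs).1.2 (hx s hs)
  obtain ⟨C, hC⟩ := isCompact_Icc.exists_bound_of_continuousOn hRc
  have hd := (intervalIntegrable_iff_integrableOn_Icc_of_le hle).1 h2.intervalIntegrable_deriv'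
  have hae := α.ae_mdifferentiableAt
  rw [intervalMeasure, ae_restrict_iff' measurableSet_Icc] at hae
  have hI : IntegrableOn (fun s ↦ R (α.leftCoord t s) (deriv (α.leftCoord t) s))
      (Icc (max 0 (t - ε)) (min 1 (t + ε))) := by
    refine (hd.norm.const_mul C).mono' (isBoundedBilinearMap_apply.continuous.comp_aestronglyMeasurable
      ((hRc.aestronglyMeasurable measurableSet_Icc).prodMk hd.1)) ?_
    filter_upwards [ae_restrict_mem measurableSet_Icc] with s hs
    exact (ContinuousLinearMap.le_opNorm _ _).trans (by gcongr; exact hC s hs)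
  refine hI.congr_fun_ae ?_
  rw [EventuallyEq, ae_restrict_iff' measurableSet_Icc]
  filter_upwards [hae] with s hs hm
  have hm' : s ∈ Icc (0 : ℝ) 1 :=
    ⟨(le_max_left _ _).trans hm.1, hm.2.trans (min_le_left _ _)⟩
  have h3 := (α.hasMFDerivAt_logDeriv (hs hm')).hasDerivAt_extChartAt_mul_left
    (α.extend t)⁻¹ (h1 hm).2
  change HasDerivAt (α.leftCoord t) (leftFrame E G (α.leftCoord t s) (α.logDeriv s)) s at h3
  rw [h3.deriv]
  exact (h1 hm).1.1.inverse_apply_eq.2 rfl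

end ACCurve

end Velocity

/-! ### Uniqueness of the curve with given start and logarithmic derivative -/

section Uniqueness

variable {E : Type*} [NormedAddCommGroup E] [NormedSpace ℝ E]
  {G : Type*} [TopologicalSpace G] [ChartedSpace E G] [Group G]

/-- The curve `α` is differentiable at `t` with `α'(t) = L_{α(t)} v`. -/
def HasLogDerivAt (α : ℝ → G) (v : E) (t : ℝ) : Prop :=
  HasMFDerivAt 𝓘(ℝ, ℝ) 𝓘(ℝ, E) α t
    ((1 : ℝ →L[ℝ] ℝ).smulRight (mulInvariantVectorField (I := 𝓘(ℝ, E)) v (α t)))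

theorem HasLogDerivAt.congr_of_eventuallyEq {α β : ℝ → G} {v : E} {t : ℝ}
    (h : HasLogDerivAt α v t) (he : β =ᶠ[𝓝 t] α) : HasLogDerivAt β v t := by
  have h1 := HasMFDerivAt.congr_of_eventuallyEq h he
  rw [HasLogDerivAt]
  rw [← he.eq_of_nhds] at h1
  exact h1

namespace ACCurve

variable [LieGroup 𝓘(ℝ, E) ∞ G] {u : ℝ → E}

theorem exists_hasDerivAt_leftCoord (α : ACCurve E G)
    (hα : ∀ᵐ t ∂intervalMeasure, HasLogDerivAt α.extend (u t) t) {t : ℝ}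
    (ht : t ∈ Icc (0 : ℝ) 1) {s : Set ℝ} (hs : s ∈ 𝓝[Icc 0 1] t) :
    ∃ ε > 0, Icc (max 0 (t - ε)) (min 1 (t + ε)) ⊆ s ∧
      AbsolutelyContinuousOnInterval (α.leftCoord t) (max 0 (t - ε)) (min 1 (t + ε)) ∧
      ∀ᵐ τ : ℝ, τ ∈ Icc (max 0 (t - ε)) (min 1 (t + ε)) →
        HasDerivAt (α.leftCoord t) (leftFrame E G (α.leftCoord t τ) (u τ)) τ := by
  obtain ⟨ε, hε, h1, h2⟩ := (α.acNear_leftCoord ht).exists_subset ht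
    (inter_mem hs (mem_nhdsWithin_of_mem_nhds (α.eventually_mem_source t)))
  refine ⟨ε, hε, fun x hx ↦ (h1 hx).1, h2, ?_⟩
  rw [intervalMeasure, ae_restrict_iff' measurableSet_Icc] at hα
  filter_upwards [hα] with τ hτ hm
  have hm' : τ ∈ Icc (0 : ℝ) 1 :=
    ⟨(le_max_left _ _).trans hm.1, hm.2.trans (min_le_left _ _)⟩
  exact (hτ hm').hasDerivAt_extChartAt_mul_left (α.extend t)⁻¹ (h1 hm).2

variable [FiniteDimensional ℝ E]

/-- Translated by the inverse of their common value at `t`, both curves start at the identity and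
solve the same Carathéodory equation in the chart. -/
theorem eventually_eq_of_hasLogDerivAt (α β : ACCurve E G) (hu : Integrable u)
    (hα : ∀ᵐ t ∂intervalMeasure, HasLogDerivAt α.extend (u t) t)
    (hβ : ∀ᵐ t ∂intervalMeasure, HasLogDerivAt β.extend (u t) t)
    {t : ℝ} (ht : t ∈ Ico (0 : ℝ) 1) (h : α.extend t = β.extend t) :
    ∀ᶠ s in 𝓝[>] t, α.extend s = β.extend s := by
  have ht' : t ∈ Icc (0 : ℝ) 1 := ⟨ht.1, ht.2.le⟩
  obtain ⟨K, S, hS, hK⟩ := (contDiffAt_leftFrame (E := E) (G := G)).exists_lipschitzOnWith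
  have hmem (γ : ACCurve E G) : γ.leftCoord t ⁻¹' S ∩
      {s | (γ.extend t)⁻¹ * γ.extend s ∈ (extChartAt 𝓘(ℝ, E) (1 : G)).source} ∈
      𝓝[Icc 0 1] t := by
    refine inter_mem (((γ.acNear_leftCoord ht').continuousWithinAt ht').preimage_mem_nhdsWithin ?_)
      (mem_nhdsWithin_of_mem_nhds (γ.eventually_mem_source t))
    rwa [leftCoord_self]
  obtain ⟨ε, hε, hxS, hx, hx'⟩ := α.exists_hasDerivAt_leftCoord hα ht' (hmem α)
  obtain ⟨δ, hδ, hyS, hy, hy'⟩ := β.exists_hasDerivAt_leftCoord hβ ht' (hmem β)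
  have hint : Tendsto (fun b ↦ K * ∫ τ in t..b, ‖u τ‖) (𝓝[>] t) (𝓝 0) := by
    have h1 : Continuous fun b ↦ K * ∫ τ in t..b, ‖u τ‖ := continuous_const.mul
      (intervalIntegral.continuous_primitive (fun _ _ ↦ hu.norm.intervalIntegrable) t)
    have h2 := h1.tendsto t
    rw [intervalIntegral.integral_same, mul_zero] at h2
    exact h2.mono_left nhdsWithin_le_nhds
  have hb1 : ∀ η > 0, ∀ᶠ b in 𝓝[>] t, b ≤ min 1 (t + η) := fun η hη ↦
    mem_nhdsWithin_of_mem_nhds (Iic_mem_nhds (lt_min ht.2 (by linarith)))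
  -- Up to `b` both curves stay in the chart and in the Lipschitz set, and the mass of `u` on `[t,
  -- b]` makes the estimate a contraction.
  obtain ⟨b, hbt, hbε, hbδ, hb⟩ := (eventually_mem_nhdsWithin.and ((hb1 ε hε).and
    ((hb1 δ hδ).and (hint.eventually (eventually_le_nhds (half_pos one_pos)))))).exists
  have hbt' : t ≤ b := le_of_lt hbt
  have sub : ∀ η > 0, b ≤ min 1 (t + η) → Icc t b ⊆ Icc (max 0 (t - η)) (min 1 (t + η)) :=
    fun η hη hb ↦ Icc_subset_Icc (mem_Icc_max_min ht' hη.le).1 hb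
  have key : ∀ γ : ACCurve E G, ∀ η > 0, b ≤ min 1 (t + η) →
      AbsolutelyContinuousOnInterval (γ.leftCoord t) (max 0 (t - η)) (min 1 (t + η)) →
      (∀ᵐ τ : ℝ, τ ∈ Icc (max 0 (t - η)) (min 1 (t + η)) →
        HasDerivAt (γ.leftCoord t) (leftFrame E G (γ.leftCoord t τ) (u τ)) τ) →
      ContinuousOn (γ.leftCoord t) (Icc t b) ∧
      IntervalIntegrable (fun τ ↦ leftFrame E G (γ.leftCoord t τ) (u τ)) volume t b ∧
      ∀ s ∈ Icc t b, γ.leftCoord t s = γ.leftCoord t t +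
        ∫ τ in t..s, leftFrame E G (γ.leftCoord t τ) (u τ) := by
    intro γ η hη hb hac hd
    have hac' : AbsolutelyContinuousOnInterval (γ.leftCoord t) t b := by
      refine hac.mono ?_
      rw [uIcc_of_le hbt', uIcc_of_le (max_sub_le_min_add ht' hη.le)]
      exact sub η hη hb
    have hd' : ∀ᵐ τ : ℝ, τ ∈ Icc t b →
        HasDerivAt (γ.leftCoord t) (leftFrame E G (γ.leftCoord t τ) (u τ)) τ := by
      filter_upwards [hd] with τ hτ hm using hτ (sub η hη hb hm)
    -- The integrand is almost everywhere the derivative of an absolutely continuous function.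
    have hi : IntervalIntegrable (fun τ ↦ leftFrame E G (γ.leftCoord t τ) (u τ)) volume t b := by
      refine hac'.intervalIntegrable_deriv'.congr_ae ?_
      rw [EventuallyEq, ae_restrict_iff' measurableSet_uIoc]
      filter_upwards [hd'] with τ hτ hm
      rw [uIoc_of_le hbt'] at hm
      exact (hτ (Ioc_subset_Icc_self hm)).deriv
    have hc := hac'.continuousOn
    rw [uIcc_of_le hbt'] at hc
    exact ⟨hc, hi, fun s hs ↦ hac'.eq_add_integral hbt' hi hd' hs⟩
  obtain ⟨hxc, hxi, hxe⟩ := key α ε hε hbε hx hx'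
  obtain ⟨hyc, hyi, hye⟩ := key β δ hδ hbδ hy hy'
  have heq := eqOn_of_caratheodory_solution hK hu.intervalIntegrable hbt' hb hxc hyc
    (fun s hs ↦ (hxS (sub ε hε hbε hs)).1) (fun s hs ↦ (hyS (sub δ hδ hbδ hs)).1) hxe hye hxi hyi
    (by rw [leftCoord_self, leftCoord_self])
  filter_upwards [Ioc_mem_nhdsGT hbt] with s hs
  have hs' : s ∈ Icc t b := Ioc_subset_Icc_self hs
  have h1 := (extChartAt 𝓘(ℝ, E) (1 : G)).injOn (hxS (sub ε hε hbε hs')).2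
    (hyS (sub δ hδ hbδ hs')).2 (heq hs')
  rw [h] at h1
  exact mul_left_cancel h1

/-- Continuous induction on `[0,1]`: the agreement set is closed, contains `0` and extends to the
right of each of its points before `1`. -/
theorem eq_of_hasLogDerivAt [T2Space G] (α β : ACCurve E G) (hu : Integrable u)
    (hα : ∀ᵐ t ∂intervalMeasure, HasLogDerivAt α.extend (u t) t)
    (hβ : ∀ᵐ t ∂intervalMeasure, HasLogDerivAt β.extend (u t) t)
    (h : α.curve 0 = β.curve 0) : α = β := by
  refine ext_of_eqOn_extend ?_
  have hcl : IsClosed {t | α.extend t = β.extend t} :=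
    isClosed_eq α.continuous_extend β.continuous_extend
  refine (hcl.inter isClosed_Icc).Icc_subset_of_forall_mem_nhdsWithin ?_ fun t ht ↦
    α.eventually_eq_of_hasLogDerivAt β hu hα hβ ht.2 ht.1
  have h0 : (0 : ℝ) ∈ Icc (0 : ℝ) 1 := left_mem_Icc.2 zero_le_one
  change α.extend 0 = β.extend 0
  rw [α.extend_apply h0, β.extend_apply h0]
  exact h

end ACCurve

end Uniqueness

/-! ### Existence by concatenating solutions for small controls -/

section Existence

variable {E : Type*} [NormedAddCommGroup E] [NormedSpace ℝ E] [FiniteDimensional ℝ E]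
  {G : Type*} [TopologicalSpace G] [ChartedSpace E G] [Group G] [LieGroup 𝓘(ℝ, E) ∞ G]

variable (E G) in
/-- Controls of small mass have a global solution starting at the identity, which is locally
constant off the support of the control. -/
theorem exists_pos_forall_exists_solution : ∃ η > 0, ∀ u : ℝ → E, Integrable u →
    ∫ t, ‖u t‖ ≤ η → ∀ c c' : ℝ, c ≤ c' → (∀ t, t ∉ Ioc c c' → u t = 0) →
    ∃ β : ℝ → G, Continuous β ∧
      (∀ t ∈ Icc (0 : ℝ) 1, ∃ f : ℝ → E, ACNear f t ∧ ∃ Φ : E → G,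
        ContMDiffAt 𝓘(ℝ, E) 𝓘(ℝ, E) ∞ Φ (f t) ∧ β = fun s ↦ Φ (f s)) ∧
      (∀ t ≤ c, β t = 1) ∧ (∀ t ≥ c', β t = β c') ∧
      ∀ g : G, ∀ᵐ t : ℝ, HasLogDerivAt (fun s ↦ g * β s) (u t) t := by
  have : CompleteSpace E := FiniteDimensional.complete ℝ E
  set φ := extChartAt 𝓘(ℝ, E) (1 : G) with hφ
  obtain ⟨K, S, hS, hK⟩ := (contDiffAt_leftFrame (E := E) (G := G)).exists_lipschitzOnWith
  have hbd : ∀ᶠ x in 𝓝 (φ 1), ‖leftFrame E G x‖ < ‖leftFrame E G (φ 1)‖ + 1 :=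
    contDiffAt_leftFrame.continuousAt.norm.eventually (gt_mem_nhds (lt_add_one _))
  set M := ‖leftFrame E G (φ 1)‖ + 1
  have hM0 : 0 < M := by positivity
  obtain ⟨r, hr, hball⟩ := Metric.nhds_basis_closedBall.mem_iff.1
    (inter_mem (inter_mem hS hbd) (extChartAt_target_mem_nhds (I := 𝓘(ℝ, E)) (1 : G)))
  -- The first bound makes the Picard operator contract (`K + 1` avoids dividing by zero); the
  -- second keeps solutions in the ball of radius `r`.
  refine ⟨min (1 / (2 * (K + 1))) (r / M), by positivity, fun u hu hη c c' hc hsupp ↦ ?_⟩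
  have hKu : K * ∫ t, ‖u t‖ ≤ 1 / 2 := by
    have h1 := hη.trans (min_le_left _ _)
    rw [le_div_iff₀ (by positivity)] at h1
    have h2 : 0 ≤ ∫ t, ‖u t‖ := integral_nonneg fun _ ↦ norm_nonneg _
    linarith
  have hMu : M * ∫ t, ‖u t‖ ≤ r := by
    have h1 := hη.trans (min_le_right _ _)
    rwa [le_div_iff₀ hM0, mul_comm] at h1
  obtain ⟨x, hxc, hxB, hxi, hx⟩ := exists_caratheodory_solution hr.le
    (hK.mono fun y hy ↦ (hball hy).1.1)
    (fun y hy ↦ le_of_lt (show ‖leftFrame E G y‖ < M from (hball hy).1.2)) hu c hKu hMu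
  have htgt : ∀ t, x t ∈ φ.target := fun t ↦ (hball (hxB t)).2
  have hsm : ∀ t, ContMDiffAt 𝓘(ℝ, E) 𝓘(ℝ, E) ∞ φ.symm (x t) := fun t ↦
    contMDiffAt_extChartAt_symm 1 (htgt t)
  refine ⟨fun t ↦ φ.symm (x t), ?_, ?_, ?_, ?_, ?_⟩
  · exact continuous_iff_continuousAt.2 fun t ↦ (hsm t).continuousAt.comp hxc.continuousAt
  · refine fun t ht ↦ ⟨x, AbsolutelyContinuousOnInterval.acNear ?_ ht, φ.symm, hsm t, rfl⟩
    have h1 : AbsolutelyContinuousOnInterval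
        (fun t ↦ ∫ s in (0 : ℝ)..t, leftFrame E G (x s) (u s)) 0 1 :=
      hxi.intervalIntegrable.absolutelyContinuousOnInterval
    refine h1.of_dist_le 1 fun s _ t _ ↦ ?_
    rw [one_mul, hx s, hx t, dist_add_left, dist_eq_norm, dist_eq_norm,
      intervalIntegral.integral_interval_sub_left hxi.intervalIntegrable hxi.intervalIntegrable,
      intervalIntegral.integral_interval_sub_left hxi.intervalIntegrable hxi.intervalIntegrable]
  · intro t ht
    have h1 : x t = φ 1 := by
      rw [hx t, intervalIntegral.integral_symm, intervalIntegral.integral_zero_ae, neg_zero,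
        add_zero]
      refine .of_forall fun s hs ↦ ?_
      rw [uIoc_of_le ht] at hs
      rw [hsupp s fun h ↦ absurd h.1 (not_lt.2 hs.2), map_zero]
    change φ.symm (x t) = 1
    rw [h1]
    exact extChartAt_to_inv _
  · intro t ht
    have h1 : x t = x c' := by
      rw [hx t, hx c', ← sub_eq_zero, add_sub_add_left_eq_sub,
        intervalIntegral.integral_interval_sub_left hxi.intervalIntegrable hxi.intervalIntegrable,
        intervalIntegral.integral_zero_ae]
      refine .of_forall fun s hs ↦ ?_
      rw [uIoc_of_le ht] at hs
      rw [hsupp s fun h ↦ absurd h.2 (not_le.2 hs.1), map_zero]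
    change φ.symm (x t) = φ.symm (x c')
    rw [h1]
  · intro g
    filter_upwards [LocallyIntegrable.ae_hasDerivAt_integral hxi.locallyIntegrable] with t ht
    refine HasMFDerivAt.mul_left_extChartAt_symm g (htgt t) ?_
    exact ((ht c).const_add (φ 1)).congr_of_eventuallyEq (.of_forall hx)

/-- `α` starts at `g`, is locally absolutely continuous on `[0,1]`, has logarithmic derivative `u`
almost everywhere before time `c`, and is constant after time `c`. -/
structure IsStoppedSolution (u : ℝ → E) (g : G) (c : ℝ) (α : ℝ → G) : Prop where
  continuous : Continuous α
  apply_zero : α 0 = g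
  acNear : ∀ t ∈ Icc (0 : ℝ) 1, ACNear (fun s ↦ extChartAt 𝓘(ℝ, E) (α t) (α s)) t
  hasLogDerivAt : ∀ᵐ t : ℝ, t ∈ Ioo 0 c → HasLogDerivAt α (u t) t
  eq_of_ge : ∀ t ≥ c, α t = α c

omit [FiniteDimensional ℝ E] in
theorem ContMDiffAt.mul_prod {Ψ Φ : E → G} {a b : E} (hΨ : ContMDiffAt 𝓘(ℝ, E) 𝓘(ℝ, E) ∞ Ψ a)
    (hΦ : ContMDiffAt 𝓘(ℝ, E) 𝓘(ℝ, E) ∞ Φ b) :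
    ContMDiffAt 𝓘(ℝ, E × E) 𝓘(ℝ, E) ∞ (fun z : E × E ↦ Ψ z.1 * Φ z.2) (a, b) :=
  (ContMDiffAt.comp (a, b) (g := Ψ) hΨ contDiff_fst.contMDiff.contMDiffAt).mul
    (ContMDiffAt.comp (a, b) (g := Φ) hΦ contDiff_snd.contMDiff.contMDiffAt)

omit [FiniteDimensional ℝ E] in
theorem ACNear.extChartAt_mul {α β : ℝ → G} {t : ℝ} (ht : t ∈ Icc (0 : ℝ) 1)
    {f₁ f₂ : ℝ → E} (h₁ : ACNear f₁ t) (h₂ : ACNear f₂ t) {Ψ Φ : E → G}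
    (hΨ : ContMDiffAt 𝓘(ℝ, E) 𝓘(ℝ, E) ∞ Ψ (f₁ t)) (hΦ : ContMDiffAt 𝓘(ℝ, E) 𝓘(ℝ, E) ∞ Φ (f₂ t))
    (hα : α =ᶠ[𝓝[Icc 0 1] t] fun s ↦ Ψ (f₁ s)) (hβ : β =ᶠ[𝓝[Icc 0 1] t] fun s ↦ Φ (f₂ s)) :
    ACNear (fun s ↦ extChartAt 𝓘(ℝ, E) (α t * β t) (α s * β s)) t := by
  have hm := hΨ.mul_prod hΦ
  have hf := h₁.prodMk h₂ ht
  obtain ⟨γ, hγ⟩ : ∃ γ : ℝ → G, ∀ s, α s * β s = γ s := ⟨_, fun _ ↦ rfl⟩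
  have h : γ =ᶠ[𝓝[Icc 0 1] t] fun s ↦ Ψ (f₁ s) * Φ (f₂ s) := by
    filter_upwards [hα, hβ] with s hs hs'
    rw [← hγ, hs, hs']
  simp only [hγ]
  exact ACNear.extChartAt_comp (f := fun s ↦ (f₁ s, f₂ s)) (Φ := fun z ↦ Ψ z.1 * Φ z.2)
    hf ht hm h

omit [FiniteDimensional ℝ E] in
-- Before `c` the factor `β` is `1`, and after `c` the factor `α` is the constant `α c`. On each
-- side the product is therefore a left translate of a single solution, and the time `c` itself is
-- negligible.
theorem IsStoppedSolution.mul {u : ℝ → E} {g : G} {c c' : ℝ} {α : ℝ → G} (h0 : 0 ≤ c)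
    (hc : c ≤ c') (hα : IsStoppedSolution u g c α) {β : ℝ → G} (hβ : Continuous β)
    (hβ' : ∀ t ∈ Icc (0 : ℝ) 1, ∃ f : ℝ → E, ACNear f t ∧ ∃ Φ : E → G,
        ContMDiffAt 𝓘(ℝ, E) 𝓘(ℝ, E) ∞ Φ (f t) ∧ β = fun s ↦ Φ (f s))
    (h1 : ∀ t ≤ c, β t = 1) (h2 : ∀ t ≥ c', β t = β c')
    (h3 : ∀ g : G, ∀ᵐ t : ℝ, t ∈ Ioo c c' → HasLogDerivAt (fun s ↦ g * β s) (u t) t) :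
    IsStoppedSolution u g c' (fun t ↦ α t * β t) where
  continuous := by
    have : IsTopologicalGroup G := topologicalGroup_of_lieGroup 𝓘(ℝ, E) ∞
    exact hα.continuous.mul hβ
  apply_zero := by rw [h1 0 h0, mul_one, hα.apply_zero]
  acNear t ht := by
    obtain ⟨f, hf, Φ, hΦ, hfΦ⟩ := hβ' t ht
    refine (hα.acNear t ht).extChartAt_mul ht hf
      (contMDiffAt_extChartAt_symm (α t) (mem_extChartAt_target _)) hΦ ?_ (.of_eq hfΦ)
    filter_upwards [mem_nhdsWithin_of_mem_nhds (hα.continuous.continuousAt.preimage_mem_nhds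
      (extChartAt_source_mem_nhds (I := 𝓘(ℝ, E)) (α t)))] with s hs
    rw [PartialEquiv.left_inv _ hs]
  hasLogDerivAt := by
    have hne : ∀ᵐ t : ℝ, t ≠ c := by simp [ae_iff, measure_singleton]
    filter_upwards [hα.hasLogDerivAt, h3 (α c), hne] with t ht ht' htc hm
    rcases lt_or_gt_of_ne htc with h | h
    · refine (ht ⟨hm.1, h⟩).congr_of_eventuallyEq ?_
      filter_upwards [Iio_mem_nhds h] with s hs
      rw [h1 s (le_of_lt hs), mul_one]
    · refine (ht' ⟨h, hm.2⟩).congr_of_eventuallyEq ?_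
      filter_upwards [Ioi_mem_nhds h] with s hs
      rw [hα.eq_of_ge s (le_of_lt hs)]
  eq_of_ge t ht := by
    rw [h2 t ht, hα.eq_of_ge t (hc.trans ht), hα.eq_of_ge c' hc]

/-- Uniform continuity of the primitive of `‖u‖` gives a step `δ` on which the control has mass at
most `η`; finitely many steps reach time `1`. -/
theorem exists_isStoppedSolution {u : ℝ → E} (hu : Integrable u) (g : G) :
    ∃ α : ℝ → G, IsStoppedSolution u g 1 α := by
  obtain ⟨η, hη, H⟩ := exists_pos_forall_exists_solution E G
  obtain ⟨δ, hδ, hsmall⟩ : ∃ δ > 0, ∀ c ∈ Icc (0 : ℝ) 1, ∀ c' ∈ Icc (0 : ℝ) 1, c ≤ c' →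
      c' ≤ c + δ → ∫ t in c..c', ‖u t‖ ≤ η := by
    have hc : Continuous fun t ↦ ∫ s in (0 : ℝ)..t, ‖u s‖ :=
      intervalIntegral.continuous_primitive (fun _ _ ↦ hu.norm.intervalIntegrable) 0
    obtain ⟨δ, hδ, h⟩ := Metric.uniformContinuousOn_iff.1
      (isCompact_Icc.uniformContinuousOn_of_continuous (hc.continuousOn (s := Icc 0 1))) η hη
    refine ⟨δ / 2, by positivity, fun c hc c' hc' hcc hcd ↦ ?_⟩
    have h1 := h c' hc' c hc (by rw [Real.dist_eq, abs_lt]; constructor <;> linarith)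
    rw [Real.dist_eq, intervalIntegral.integral_interval_sub_left hu.norm.intervalIntegrable
      hu.norm.intervalIntegrable] at h1
    exact (le_abs_self _).trans h1.le
  have step : ∀ n : ℕ, ∃ α : ℝ → G, IsStoppedSolution u g (min 1 (n * δ)) α := by
    intro n
    induction n with
    | zero =>
      refine ⟨fun _ ↦ g, continuous_const, rfl, fun t ht ↦ ?_, ?_, fun _ _ ↦ rfl⟩
      · exact (LipschitzWith.const _).lipschitzOnWith.absolutelyContinuousOnInterval.acNear ht
      · refine .of_forall fun t ht ↦ ?_
        simp at ht
    | succ n ih =>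
      obtain ⟨α, hα⟩ := ih
      set c := min 1 (n * δ) with hc
      set c' := min 1 ((n + 1 : ℕ) * δ) with hc'
      have hcc : c ≤ c' := min_le_min le_rfl (by push_cast; nlinarith)
      have hc0 : 0 ≤ c := le_min zero_le_one (by positivity)
      have hcd : c' ≤ c + δ := by
        rw [hc, hc', ← min_add_add_right]
        exact min_le_min (by linarith) (by push_cast; linarith)
      have hs := hsmall c ⟨hc0, min_le_left _ _⟩ c' ⟨hc0.trans hcc, min_le_left _ _⟩ hcc hcd
      rw [intervalIntegral.integral_of_le hcc] at hs
      have hn : ∫ t, ‖(Ioc c c').indicator u t‖ ≤ η := by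
        simp_rw [norm_indicator_eq_indicator_norm]
        rwa [integral_indicator measurableSet_Ioc]
      obtain ⟨β, hβ, hβ', h1, h2, h3⟩ := H _ (hu.indicator measurableSet_Ioc) hn c c' hcc
        fun t ht ↦ indicator_of_notMem ht _
      refine ⟨_, hα.mul hc0 hcc hβ hβ' h1 h2 fun g ↦ ?_⟩
      filter_upwards [h3 g] with t ht hm
      rwa [indicator_of_mem (Ioo_subset_Ioc_self hm)] at ht
  obtain ⟨n, hn⟩ := exists_nat_gt (1 / δ)
  have h1 : min 1 (n * δ) = 1 := by
    rw [div_lt_iff₀ hδ] at hn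
    exact min_eq_left hn.le
  simpa only [h1] using step n

theorem exists_acCurve_hasLogDerivAt {u : ℝ → E} (hu : Integrable u) (g : G) :
    ∃ α : ACCurve E G, α.curve 0 = g ∧
      ∀ᵐ t ∂intervalMeasure, HasLogDerivAt α.extend (u t) t := by
  obtain ⟨α, hα⟩ := exists_isStoppedSolution hu g
  refine ⟨.ofACNear α hα.continuous hα.acNear, hα.apply_zero, ?_⟩
  rw [intervalMeasure, ae_restrict_iff' measurableSet_Icc]
  -- The extended curve is only known to match `α` on `[0,1]`, so derivatives are compared at
  -- interior times.
  have h0 : ∀ᵐ t : ℝ, t ≠ 0 := by simp [ae_iff, measure_singleton]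
  have h1 : ∀ᵐ t : ℝ, t ≠ 1 := by simp [ae_iff, measure_singleton]
  filter_upwards [hα.hasLogDerivAt, h0, h1] with t ht h0 h1 hm
  have hm' : t ∈ Ioo (0 : ℝ) 1 := ⟨lt_of_le_of_ne hm.1 h0.symm, lt_of_le_of_ne hm.2 h1⟩
  refine (ht hm').congr_of_eventuallyEq ?_
  filter_upwards [Icc_mem_nhds hm'.1 hm'.2] with s hs
  exact ACCurve.extend_ofACNear α hα.continuous hα.acNear hs

end Existence

/-! ### The square root transform between `L²` and `L¹` -/

section SquareRootVelocity

theorem norm_smul_inv_sqrt_norm_smul {V : Type*} [NormedAddCommGroup V] [NormedSpace ℝ V] (w : V) :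
    ‖(√‖w‖)⁻¹ • w‖ • (√‖w‖)⁻¹ • w = w := by
  rcases eq_or_ne w 0 with rfl | hw
  · simp
  have h : 0 < √‖w‖ := Real.sqrt_pos.2 (norm_pos_iff.2 hw)
  have h2 : √‖w‖ * √‖w‖ = ‖w‖ := Real.mul_self_sqrt (norm_nonneg w)
  have h3 : (√‖w‖)⁻¹ * ‖w‖ * (√‖w‖)⁻¹ = 1 := by
    rw [mul_comm, ← mul_assoc, ← mul_inv, h2, inv_mul_cancel₀ (norm_ne_zero_iff.2 hw)]
  rw [norm_smul, norm_inv, Real.norm_of_nonneg h.le, smul_smul, h3, one_smul]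

theorem norm_inv_sqrt_norm_smul_sq {V : Type*} [NormedAddCommGroup V] [NormedSpace ℝ V] (w : V) :
    ‖(√‖w‖)⁻¹ • w‖ ^ 2 = ‖w‖ := by
  have h := congrArg norm (norm_smul_inv_sqrt_norm_smul w)
  rwa [norm_smul, norm_norm, ← sq] at h

theorem inv_sqrt_norm_norm_smul_smul {V : Type*} [NormedAddCommGroup V] [NormedSpace ℝ V] (q : V) :
    (√‖‖q‖ • q‖)⁻¹ • ‖q‖ • q = q := by
  rcases eq_or_ne q 0 with rfl | hq
  · simp
  rw [norm_smul, norm_norm, Real.sqrt_mul_self (norm_nonneg q), smul_smul,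
    inv_mul_cancel₀ (norm_ne_zero_iff.2 hq), one_smul]

variable {E : Type*} [NormedAddCommGroup E] [NormedSpace ℝ E]
  {G : Type*} [TopologicalSpace G] [ChartedSpace E G] [Group G] [LieGroup 𝓘(ℝ, E) ∞ G]
  [RiemannianBundle (fun x : G ↦ TangentSpace 𝓘(ℝ, E) x)]

variable (E G) in
/-- The identity map from the model space to the Lie algebra with its Riemannian norm. -/
def modelToLieAlgebra : E ≃L[ℝ] TangentSpace 𝓘(ℝ, E) (1 : G) :=
  ContinuousLinearEquiv.refl ℝ E

/-- Left invariance replaces the norm of the velocity by that of the logarithmic derivative. The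
case of zero velocity is absorbed, since the vector being scaled is then zero. -/
theorem ACCurve.srvFun_eq (hG : IsLeftInvariantMetric E G) (α : ACCurve E G) (t : ℝ) :
    srvFun α t = (√‖modelToLieAlgebra E G (α.logDeriv t)‖)⁻¹ •
      modelToLieAlgebra E G (α.logDeriv t) := by
  set w : TangentSpace 𝓘(ℝ, E) (1 : G) := modelToLieAlgebra E G (α.logDeriv t) with hw
  have h1 : α.velocity t = mulInvariantVectorField w (α.extend t) :=
    (mulInvariantVectorField_toLieAlgebra _ _).symm
  have h2 : ‖α.velocity t‖ = ‖w‖ := by rw [h1, norm_mulInvariantVectorField hG]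
  rw [srvFun, h2]
  split_ifs with h
  · rw [h, norm_zero] at h2
    rw [norm_eq_zero.1 h2.symm, smul_zero]
  · exact map_smul (mfderiv 𝓘(ℝ, E) 𝓘(ℝ, E) (fun x : G ↦ (α.extend t)⁻¹ * x) (α.extend t)) _ _

omit [LieGroup 𝓘(ℝ, E) ∞ G] in
theorem integrable_norm_smul (q : L2LieAlgebra E G) :
    Integrable (fun t ↦ ‖q t‖ • q t) intervalMeasure := by
  have hq := Lp.memLp q
  refine (((memLp_two_iff_integrable_sq_norm hq.1).1 hq)).mono' (hq.1.norm.smul hq.1)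
    (.of_forall fun t ↦ ?_)
  rw [norm_smul, norm_norm, sq]

variable [FiniteDimensional ℝ E]

theorem ACCurve.memLp_srvFun (hG : IsLeftInvariantMetric E G) (α : ACCurve E G) :
    MemLp (srvFun α) 2 intervalMeasure := by
  have h1 : Integrable (fun t ↦ modelToLieAlgebra E G (α.logDeriv t)) intervalMeasure :=
    ContinuousLinearMap.integrable_comp (μ := intervalMeasure)
      (modelToLieAlgebra E G).toContinuousLinearMap α.integrableOn_logDeriv
  have h2 : srvFun α = fun t ↦ (√‖modelToLieAlgebra E G (α.logDeriv t)‖)⁻¹ •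
      modelToLieAlgebra E G (α.logDeriv t) := funext (α.srvFun_eq hG)
  have h3 : AEStronglyMeasurable (srvFun α) intervalMeasure := by
    rw [h2]
    exact (h1.1.norm.aemeasurable.sqrt.inv.aestronglyMeasurable).smul h1.1
  rw [memLp_two_iff_integrable_sq_norm h3, h2]
  simp_rw [norm_inv_sqrt_norm_smul_sq]
  exact h1.norm

theorem srvMap_eq_iff (hG : IsLeftInvariantMetric E G)
    (h : ∀ α : ACCurve E G, MemLp (srvFun α) 2 intervalMeasure)
    (α : ACCurve E G) (α₀ : G) (q : L2LieAlgebra E G) :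
    srvMap h α = (α₀, q) ↔ SolvesSRVEquation α α₀ q := by
  rw [srvMap, Prod.mk.injEq, SolvesSRVEquation]
  refine and_congr_right fun _ ↦ ?_
  have h1 : (h α).toLp (srvFun α) = q ↔ srvFun α =ᵐ[intervalMeasure] q := by
    rw [Lp.ext_iff]
    exact ⟨(h α).coeFn_toLp.symm.trans, (h α).coeFn_toLp.trans⟩
  rw [h1]
  constructor
  · intro hq
    filter_upwards [hq, α.ae_mdifferentiableAt] with t ht hd
    have h2 := α.hasMFDerivAt_logDeriv hd
    have h3 : α.logDeriv t = ‖q t‖ • q t := by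
      rw [← ht, α.srvFun_eq hG]
      exact (norm_smul_inv_sqrt_norm_smul (modelToLieAlgebra E G (α.logDeriv t))).symm
    rwa [h3] at h2
  · intro hq
    filter_upwards [hq] with t ht
    have h2 : modelToLieAlgebra E G (α.logDeriv t) = ‖q t‖ • q t := α.logDeriv_eq ht
    rw [α.srvFun_eq hG, h2, inv_sqrt_norm_norm_smul_smul]

/-- The control `‖q‖ q` with values in the model space, extended by zero outside `[0,1]`. -/
noncomputable def srvControl (q : L2LieAlgebra E G) : ℝ → E :=
  (Icc 0 1).indicator fun t ↦ (modelToLieAlgebra E G).symm (‖q t‖ • q t)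

omit [FiniteDimensional ℝ E] [LieGroup 𝓘(ℝ, E) ∞ G] in
theorem integrable_srvControl (q : L2LieAlgebra E G) : Integrable (srvControl q) := by
  refine (integrable_indicator_iff measurableSet_Icc).2 ?_
  exact ContinuousLinearMap.integrable_comp (μ := intervalMeasure)
    (modelToLieAlgebra E G).symm.toContinuousLinearMap
    (integrable_norm_smul q)

omit [FiniteDimensional ℝ E] [LieGroup 𝓘(ℝ, E) ∞ G] in
theorem solvesSRVEquation_iff (α : ACCurve E G) (α₀ : G) (q : L2LieAlgebra E G) :
    SolvesSRVEquation α α₀ q ↔ α.curve 0 = α₀ ∧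
      ∀ᵐ t ∂intervalMeasure, HasLogDerivAt α.extend (srvControl q t) t := by
  refine and_congr_right fun _ ↦ ?_
  have h : ∀ᵐ t ∂intervalMeasure, t ∈ Icc (0 : ℝ) 1 := ae_restrict_mem measurableSet_Icc
  refine eventually_congr ?_
  filter_upwards [h] with t ht
  rw [srvControl, indicator_of_mem ht]
  rfl

end SquareRootVelocity

theorem mainTheorem1 {E : Type*} [NormedAddCommGroup E] [NormedSpace ℝ E] [FiniteDimensional ℝ E]
    {G : Type*} [TopologicalSpace G] [T2Space G] [ChartedSpace E G] [Group G]
    [LieGroup 𝓘(ℝ, E) ∞ G]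
    [RiemannianBundle (fun x : G ↦ TangentSpace 𝓘(ℝ, E) x)]
    [IsContMDiffRiemannianBundle 𝓘(ℝ, E) ∞ E (fun x : G ↦ TangentSpace 𝓘(ℝ, E) x)]
    (hG : IsLeftInvariantMetric E G) :
    (∀ α : ACCurve E G,
      ∀ᵐ t ∂intervalMeasure, MDifferentiableAt 𝓘(ℝ, ℝ) 𝓘(ℝ, E) α.extend t) ∧
    (∀ q : L2LieAlgebra E G, Integrable (fun t ↦ ‖q t‖ • q t) intervalMeasure) ∧
    ∃ h : ∀ α : ACCurve E G, MemLp (srvFun α) 2 intervalMeasure,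
      Function.Bijective (srvMap h) ∧
      ∀ (α : ACCurve E G) (α₀ : G) (q : L2LieAlgebra E G),
        srvMap h α = (α₀, q) ↔ SolvesSRVEquation α α₀ q := by
  have hL (α : ACCurve E G) := α.memLp_srvFun hG
  refine ⟨fun α ↦ α.ae_mdifferentiableAt, integrable_norm_smul, hL,
    ⟨fun α β h ↦ ?_, fun ⟨α₀, q⟩ ↦ ?_⟩, srvMap_eq_iff hG hL⟩
  -- Both curves solve the equation with the data `Q(β)`, so uniqueness applies.
  · have hβ := (solvesSRVEquation_iff β _ _).1 ((srvMap_eq_iff hG hL β _ _).1 rfl)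
    have hα := (solvesSRVEquation_iff α _ _).1 ((srvMap_eq_iff hG hL α _ _).1 h)
    exact α.eq_of_hasLogDerivAt β (integrable_srvControl _) hα.2 hβ.2 hα.1
  · obtain ⟨α, h0, hα⟩ := exists_acCurve_hasLogDerivAt (integrable_srvControl q) α₀
    exact ⟨α, (srvMap_eq_iff hG hL α α₀ q).2 ((solvesSRVEquation_iff α α₀ q).2 ⟨h0, hα⟩)⟩
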